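/- **Setting.** Let $m,n,N\ge 1$ and consider the linear system $x_{t+1}=A_tx_t+B_tu_t+D_tw_t+\xi_t$, $0\le t<N$, with $x_t\in\mathbb R^m$, $u_t=-K_tx_t\in\mathbb R^d$, $w_t=-L_tx_t\in\mathbb R^n$, and symmetric weights $Q_t\ge 0$ $(0\le t\le N)$, $R^u_t>0$, $R^w_t>0$ $(0\le t<N)$. The vectors $x_0,\xi_0,\dots,\xi_{N-1}$ are independent with common law $\mathcal D$, which has zero mean, positive-definite covariance and satisfies $\|x\|\le\vartheta$ almost surely. Write $\mathbf K=(K_t)_{t<N}$ and $\mathbf L=(L_t)_{t<N}$, with Frobenius norm $\|\mathbf L\|_F^2=\sum_t\|L_t\|_F^2$. Let $\overline{\mathcal G}(\mathbf K,\mathbf L)=\sum_{t<N}(x_t^\top Q_tx_t+u_t^\top R^u_tu_t-w_t^\top R^w_tw_t)+x_N^\top Q_Nx_N$ be the cost of one trajectory and $\mathcal G=\mathbb E[\overline{\mathcal G}]$. For $\mathbf K$ put $P_N=Q_N$ and, backwards in $t$, $P_t=Q_t+K_t^\top R^u_tK_t+(A_t-B_tK_t)^\top\big(P_{t+1}+P_{t+1}D_t(R^w_t-D_t^\top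 P_{t+1}D_t)^{-1}D_t^\top P_{t+1}\big)(A_t-B_tK_t)$. The set $\mathcal K$ consists of the $\mathbf K$ for which all $P_t\ge0$ exist with $R^w_t-D_t^\top P_{t+1}D_t>0$ for all $t<N$. For $\mathbf K\in\mathcal K$, $\mathbf L(\mathbf K)$ is given by $L_t=(-R^w_t+D_t^\top P_{t+1}D_t)^{-1}D_t^\top P_{t+1}(A_t-B_tK_t)$. For any $\mathbf L$, $P_{K_t,L_t}$ solves the Lyapunov recursion $P_{K_N,L_N}=Q_N$, $P_{K_t,L_t}=(A_t-B_tK_t-D_tL_t)^\top P_{K_{t+1},L_{t+1}}(A_t-B_tK_t-D_tL_t)+Q_t+K_t^\top R^u_tK_t-L_t^\top R^w_tL_t$, and $\mathbf H_{\mathbf K,\mathbf L}$ is the block-diagonal matrix with blocks $R^w_t-D_t^\top P_{K_{t+1},L_{t+1}}D_t$. Put $\mathcal L_{\mathbf K}(a)=\{\mathbf L:\mathcal G(\mathbf K,\mathbf L)\ge a\}$ and $d_1=nmN$. **Algorithm (zeroth-order PG).** Given $\mathbf L_0$, number of iterations $L$, batch size $M_1$, smoothing radius $r_1$ and stepsize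 $\eta$, set for $l<L$ $$\mathbf L_{l+1}=\mathbf L_l+\eta\,\frac1{M_1}\sum_{i<M_1}\frac{d_1}{r_1}\,\overline{\mathcal G}(\mathbf K,\mathbf L_l+r_1\mathbf U_l^i)\,\mathbf U^i_l,$$ where all $\mathbf U_l^i$ are uniform on $\{\|\mathbf U\|_F=1\}$, each cost comes from a fresh trajectory, and all directions and trajectory noises are independent. The output is $\overline{\mathbf L}=\mathbf L_L$, and $M_1\cdot L$ trajectories are used. **Theorem.** Fix $\mathbf K\in\mathcal K$. There are a constant $\mu_{\mathbf K}>0$ with $\|\nabla_{\mathbf L}\mathcal G(\mathbf K,\mathbf L)\|_F^2\ge\mu_{\mathbf K}\big(\mathcal G(\mathbf K,\mathbf L(\mathbf K))-\mathcal G(\mathbf K,\mathbf L)\big)$ for all $\mathbf L$, and, for every $\mathbf L$, constants $l_{\mathbf K,\mathbf L},\psi_{\mathbf K,\mathbf L},\rho_{\mathbf K,\mathbf L}>0$ with $|\mathcal G(\mathbf K,\mathbf L')-\mathcal G(\mathbf K,\mathbf L)|\le l_{\mathbf K,\mathbf L}\|\mathbf L'-\mathbf L\|_F$ and $\|\nabla_{\mathbf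 L}\mathcal G(\mathbf K,\mathbf L')-\nabla_{\mathbf L}\mathcal G(\mathbf K,\mathbf L)\|_F\le\psi_{\mathbf K,\mathbf L}\|\mathbf L'-\mathbf L\|_F$ whenever $\|\mathbf L'-\mathbf L\|_F\le\rho_{\mathbf K,\mathbf L}$, where $\mu_{\mathbf K}$ depends only on $\mathbf K$ and the problem data (including $\mathcal D$), and the other constants also on $\mathbf L$, such that for every $a$ with $\mathcal L_{\mathbf K}(a)\ne\varnothing$ the following holds. The minimum $\rho_{\mathbf K,a}:=\min_{\mathbf L\in\mathcal L_{\mathbf K}(a)}\rho_{\mathbf K,\mathbf L}$ exists, and there are $l_{\mathbf K,a}\ge l_{\mathbf K,\mathbf L}$, $\psi_{\mathbf K,a}\ge\psi_{\mathbf K,\mathbf L}$ for all $\mathbf L\in\mathcal L_{\mathbf K}(a)$, which are Lipschitz constants on $\mathcal L_{\mathbf K}(a)$ of $\mathcal G(\mathbf K,\cdot)$ and of $\nabla_{\mathbf L}\mathcal G(\mathbf K,\cdot)$ respectively, such that, with $\theta_{\mathbf K,a}=\min\{1/(2\psi_{\mathbf K,a}),\rho_{\mathbf K,a}/l_{\mathbf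 K,a}\}$: 1. For all $\mathbf L_0$ with $\mathcal G(\mathbf K,\mathbf L_0)\ge a$, all $\epsilon_1,\delta_1\in(0,1)$, all natural numbers $L,M_1$ and all $r_1,\eta>0$ with $$M_1\ge\Big(\tfrac{d_1}{r_1}\big(\mathcal G(\mathbf K,\mathbf L(\mathbf K))+\tfrac{l_{\mathbf K,a}}{\rho_{\mathbf K,a}}\big)\sqrt{\log(2d_1L/\delta_1)}\Big)^2\frac{1024}{\mu_{\mathbf K}\epsilon_1},$$ $$r_1\le\min\Big\{\tfrac{\theta_{\mathbf K,a}\mu_{\mathbf K}}{8\psi_{\mathbf K,a}}\sqrt{\tfrac{\epsilon_1}{240}},\ \tfrac1{8\psi_{\mathbf K,a}^2}\sqrt{\tfrac{\epsilon_1\mu_{\mathbf K}}{30}},\ \rho_{\mathbf K,a}\Big\},\qquad \eta\le\min\Big\{1,\ \tfrac1{8\psi_{\mathbf K,a}},\ \rho_{\mathbf K,a}\big[\tfrac{\sqrt{\mu_{\mathbf K}}}{32}+\psi_{\mathbf K,a}+l_{\mathbf K,a}\big]^{-1}\Big\},$$ $$L\ge\frac{8}{\eta\mu_{\mathbf K}}\log\Big(\frac{2\max\{1,\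 \mathcal G(\mathbf K,\mathbf L(\mathbf K))-\mathcal G(\mathbf K,\mathbf L_0)\}}{\epsilon_1}\Big),$$ the output satisfies, with probability at least $1-\delta_1$, both $\mathcal G(\mathbf K,\overline{\mathbf L})\ge\mathcal G(\mathbf K,\mathbf L(\mathbf K))-\epsilon_1$ and $\|\mathbf L(\mathbf K)-\overline{\mathbf L}\|_F\le\sqrt{\lambda_{\min}^{-1}(\mathbf H_{\mathbf K,\mathbf L(\mathbf K)})\,\epsilon_1}$. 2. The total sample complexity is $\tilde{\mathcal O}(\epsilon_1^{-2}\log(1/\delta_1))$: there is a constant $C$, independent of $\mathbf L_0\in\mathcal L_{\mathbf K}(a)$, $\epsilon_1$ and $\delta_1$, such that for all these the requirements in 1 can be met with $M_1\cdot L\le C\,\epsilon_1^{-2}\,\log^2(2/\epsilon_1)\,\log(2/\delta_1)$. -/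

import Mathlib

open MeasureTheory
open scoped Matrix

noncomputable section

namespace ZOGame

/-- The space of gain sequences `(L_0, …, L_{N-1})` of real `p × m` matrices. The norm is
`√(∑ₜ ‖L_t‖_F²)`, that is, the Frobenius norm of the block matrix `[diag(L_0, …, L_{N-1})  0]`;
its dimension is `p * m * N`. -/
abbrev Gain (p m N : ℕ) : Type := EuclideanSpace ℝ (Fin N × Fin p × Fin m)

/-- The gain matrix `L_t` used at time `t`. -/
def Gain.mat {p m N : ℕ} (L : Gain p m N) (t : Fin N) : Matrix (Fin p) (Fin m) ℝ :=
  Matrix.of fun i j => L (t, i, j)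

/-- The gain sequence with prescribed matrices. -/
def Gain.ofMat {p m N : ℕ} (L : Fin N → Matrix (Fin p) (Fin m) ℝ) : Gain p m N :=
  WithLp.toLp 2 fun q => L q.1 q.2.1 q.2.2

/-- Data of a finite-horizon, time-varying zero-sum linear-quadratic dynamic game
`x_{t+1} = A_t x_t + B_t u_t + D_t w_t + ξ_t`, `0 ≤ t < N`, with state in `ℝ^m`, minimizing control
in `ℝ^d`, maximizing control in `ℝ^n` and symmetric weights `Q_t ≥ 0`, `R^u_t > 0`, `R^w_t > 0`. -/
structure LQGame (m n d N : ℕ) where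
  A : Fin N → Matrix (Fin m) (Fin m) ℝ
  B : Fin N → Matrix (Fin m) (Fin d) ℝ
  D : Fin N → Matrix (Fin m) (Fin n) ℝ
  Q : Fin (N + 1) → Matrix (Fin m) (Fin m) ℝ
  Ru : Fin N → Matrix (Fin d) (Fin d) ℝ
  Rw : Fin N → Matrix (Fin n) (Fin n) ℝ
  Q_posSemidef : ∀ t, (Q t).PosSemidef
  Ru_posDef : ∀ t, (Ru t).PosDef
  Rw_posDef : ∀ t, (Rw t).PosDef

/-- A realization `(x_0, ξ_0, …, ξ_{N-1})` of the initial state and the process noises. -/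
abbrev Noise (m N : ℕ) : Type := Fin (N + 1) → EuclideanSpace ℝ (Fin m)

/-- The law of `(x_0, ξ_0, …, ξ_{N-1})`: independent, all with distribution `𝒟`. -/
def noiseLaw {m : ℕ} (N : ℕ) (𝒟 : Measure (EuclideanSpace ℝ (Fin m))) : Measure (Noise m N) :=
  Measure.pi fun _ => 𝒟

/-- The matrix of second moments `𝔼[x xᵀ]` of `x ∼ 𝒟` (the covariance if `𝒟` is centered). -/
def secondMoment {m : ℕ} (𝒟 : Measure (EuclideanSpace ℝ (Fin m))) : Matrix (Fin m) (Fin m) ℝ :=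
  Matrix.of fun i j => ∫ x, x i * x j ∂𝒟

/-- The smallest eigenvalue of a symmetric real matrix. -/
def lambdaMin {ι : Type} [Fintype ι] [DecidableEq ι] (M : Matrix ι ι ℝ) : ℝ :=
  sInf (spectrum ℝ M)

namespace LQGame

variable {m n d N : ℕ} (S : LQGame m n d N)

/-- The closed-loop matrix `A_t - B_t K_t - D_t L_t`. -/
def closedLoop (K : Gain d m N) (L : Gain n m N) (t : Fin N) : Matrix (Fin m) (Fin m) ℝ :=
  S.A t - S.B t * K.mat t - S.D t * L.mat t

/-- The states `x_0, …, x_N` under `u_t = -K_t x_t` and `w_t = -L_t x_t`. -/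
def state (K : Gain d m N) (L : Gain n m N) (ζ : Noise m N) : Fin (N + 1) → (Fin m → ℝ) :=
  Fin.induction (motive := fun _ => Fin m → ℝ) (ζ 0).ofLp
    fun t x => S.closedLoop K L t *ᵥ x + (ζ t.succ).ofLp

/-- The total cost of one trajectory,
`∑_{t<N} (x_tᵀ Q_t x_t + u_tᵀ R^u_t u_t - w_tᵀ R^w_t w_t) + x_Nᵀ Q_N x_N`. -/
def rolloutCost (K : Gain d m N) (L : Gain n m N) (ζ : Noise m N) : ℝ :=
  let x := S.state K L ζ
  let u := fun t : Fin N => -(K.mat t *ᵥ x t.castSucc)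
  let w := fun t : Fin N => -(L.mat t *ᵥ x t.castSucc)
  (∑ t : Fin N, (x t.castSucc ⬝ᵥ (S.Q t.castSucc *ᵥ x t.castSucc) + u t ⬝ᵥ (S.Ru t *ᵥ u t)
      - w t ⬝ᵥ (S.Rw t *ᵥ w t)))
    + x (Fin.last N) ⬝ᵥ (S.Q (Fin.last N) *ᵥ x (Fin.last N))

/-- The objective `𝒢(K, L)`, the expected total cost. -/
def cost (𝒟 : Measure (EuclideanSpace ℝ (Fin m))) (K : Gain d m N) (L : Gain n m N) : ℝ :=
  ∫ ζ, S.rolloutCost K L ζ ∂(noiseLaw N 𝒟)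

/-- The solution `P_{K_t, L_t}` of the backward Lyapunov recursion with `P_{K_N, L_N} = Q_N`. -/
def lyapunov (K : Gain d m N) (L : Gain n m N) : Fin (N + 1) → Matrix (Fin m) (Fin m) ℝ :=
  Fin.reverseInduction (motive := fun _ => Matrix (Fin m) (Fin m) ℝ) (S.Q (Fin.last N))
    fun t P => (S.closedLoop K L t)ᵀ * P * S.closedLoop K L t + S.Q t.castSucc
      + (K.mat t)ᵀ * S.Ru t * K.mat t - (L.mat t)ᵀ * S.Rw t * L.mat t

/-- The solution `P_{K_t, L(K_t)}` of the backward Riccati recursion of the inner maximization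
problem, with terminal value `Q_N`. (The inverse is meaningful for `K ∈ S.feasible`.) -/
def riccati (K : Gain d m N) : Fin (N + 1) → Matrix (Fin m) (Fin m) ℝ :=
  Fin.reverseInduction (motive := fun _ => Matrix (Fin m) (Fin m) ℝ) (S.Q (Fin.last N))
    fun t P => S.Q t.castSucc + (K.mat t)ᵀ * S.Ru t * K.mat t
      + (S.A t - S.B t * K.mat t)ᵀ
        * (P + P * S.D t * (S.Rw t - (S.D t)ᵀ * P * S.D t)⁻¹ * (S.D t)ᵀ * P)
        * (S.A t - S.B t * K.mat t)

/-- The feasible set `𝒦`: the Riccati recursion has a positive semidefinite solution with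
`R^w_t - D_tᵀ P_{t+1} D_t > 0` for all `t < N`. -/
def feasible : Set (Gain d m N) :=
  {K | (∀ t, (S.riccati K t).PosSemidef) ∧
    ∀ t : Fin N, (S.Rw t - (S.D t)ᵀ * S.riccati K t.succ * S.D t).PosDef}

/-- The inner-loop solution `L(K)`, with
`L_t = (-R^w_t + D_tᵀ P_{t+1} D_t)⁻¹ D_tᵀ P_{t+1} (A_t - B_t K_t)`. -/
def innerSol (K : Gain d m N) : Gain n m N :=
  Gain.ofMat fun t => (-S.Rw t + (S.D t)ᵀ * S.riccati K t.succ * S.D t)⁻¹ * (S.D t)ᵀ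
    * S.riccati K t.succ * (S.A t - S.B t * K.mat t)

/-- The block-diagonal matrix `H_{K, L}` with blocks `R^w_t - D_tᵀ P_{K_{t+1}, L_{t+1}} D_t`. -/
def H (K : Gain d m N) (L : Gain n m N) : Matrix (Fin n × Fin N) (Fin n × Fin N) ℝ :=
  Matrix.blockDiagonal fun t => S.Rw t - (S.D t)ᵀ * S.lyapunov K L t.succ * S.D t

/-- The superlevel set `ℒ_K(a)`. -/
def superlevel (𝒟 : Measure (EuclideanSpace ℝ (Fin m))) (K : Gain d m N) (a : ℝ) :
    Set (Gain n m N) :=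
  {L | a ≤ S.cost 𝒟 K L}

/-- On the set of pairs related by `R`, the objective `𝒢(K, ·)` is `l`-Lipschitz and its gradient
(for the Frobenius inner product) is `ψ`-Lipschitz. -/
def LipSmooth (𝒟 : Measure (EuclideanSpace ℝ (Fin m))) (K : Gain d m N) (l ψ : ℝ)
    (R : Gain n m N → Gain n m N → Prop) : Prop :=
  ∀ L L', R L L' →
    |S.cost 𝒟 K L' - S.cost 𝒟 K L| ≤ l * ‖L' - L‖ ∧
    ‖gradient (S.cost 𝒟 K) L' - gradient (S.cost 𝒟 K) L‖ ≤ ψ * ‖L' - L‖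

/-- `𝒢(K, ·)` is `μ`-PL: `‖∇_L 𝒢(K, L)‖_F² ≥ μ (𝒢(K, L(K)) - 𝒢(K, L))` for all `L`. -/
def IsPL (𝒟 : Measure (EuclideanSpace ℝ (Fin m))) (K : Gain d m N) (μ : ℝ) : Prop :=
  ∀ L : Gain n m N,
    μ * (S.cost 𝒟 K (S.innerSol K) - S.cost 𝒟 K L) ≤ ‖gradient (S.cost 𝒟 K) L‖ ^ 2

end LQGame

/-- The uniform distribution on the unit Frobenius sphere of the space of gains. -/
def uniformSphere (p m N : ℕ) : Measure (Metric.sphere (0 : Gain p m N) 1) :=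
  ((volume : Measure (Gain p m N)).toSphere Set.univ)⁻¹ •
    (volume : Measure (Gain p m N)).toSphere

/-- One random sample of the oracle: a direction `U` and the noises of one trajectory. -/
abbrev Sample (n m N : ℕ) : Type := Metric.sphere (0 : Gain n m N) 1 × Noise m N

/-- The law of all samples of a run with `T` iterations and batch size `M`: the `T * M` samples
are independent, each with `U` uniform on the sphere and independent of the noises. -/
def runLaw {m : ℕ} (n N : ℕ) (𝒟 : Measure (EuclideanSpace ℝ (Fin m))) (T M : ℕ) :
    Measure (Fin T → Fin M → Sample n m N) :=
  Measure.pi fun _ => Measure.pi fun _ => (uniformSphere n m N).prod (noiseLaw N 𝒟)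

namespace LQGame

variable {m n d N : ℕ} (S : LQGame m n d N)

/-- The one-point minibatch gradient estimate
`(1/M) ∑_i (d₁/r) · cost of one trajectory under (K, L + r Uⁱ) · Uⁱ`, with `d₁ = n m N`. -/
def gradEst (K : Gain d m N) {M : ℕ} (r : ℝ) (L : Gain n m N) (b : Fin M → Sample n m N) :
    Gain n m N :=
  (1 / (M : ℝ)) • ∑ i : Fin M,
    (((n * m * N : ℕ) : ℝ) / r * S.rolloutCost K (L + r • ((b i).1 : Gain n m N)) (b i).2) •
      ((b i).1 : Gain n m N)

/-- The output `L_T` of `T` steps `L_{l+1} = L_l + η ∇̄_L 𝒢(K, L_l)` of zeroth-order policy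
gradient, where step `l` uses the minibatch `ω l`. -/
def zopg (K : Gain d m N) (L₀ : Gain n m N) {M : ℕ} (r η : ℝ) :
    (T : ℕ) → (Fin T → Fin M → Sample n m N) → Gain n m N
  | 0, _ => L₀
  | T + 1, ω =>
    let L := zopg K L₀ r η T fun l => ω l.castSucc
    L + η • S.gradEst K r L (ω (Fin.last T))

/-- The requirements on the number of iterations `T`, batch size `M`, smoothing radius `r` and
stepsize `η`. Here `Gs = 𝒢(K, L(K))`, `Δ₀ = 𝒢(K, L(K)) - 𝒢(K, L₀)`, `d₁ = n m N`. -/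
structure Admissible (d₁ : ℕ) (Gs Δ₀ μ l ψ ρ ε δ : ℝ) (T M : ℕ) (r η : ℝ) : Prop where
  r_pos : 0 < r
  η_pos : 0 < η
  iterations : 8 / (η * μ) * Real.log (2 * max 1 Δ₀ / ε) ≤ T
  batch : (d₁ / r * (Gs + l / ρ) * √(Real.log (2 * d₁ * T / δ))) ^ 2 * (1024 / (μ * ε)) ≤ M
  radius : r ≤ min (min (min (1 / (2 * ψ)) (ρ / l) * μ / (8 * ψ) * √(ε / 240))
    (1 / (8 * ψ ^ 2) * √(ε * μ / 30))) ρ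
  stepsize : η ≤ min (min 1 (1 / (8 * ψ))) (ρ * (√μ / 32 + ψ + l)⁻¹)

end LQGame

end ZOGame

end

/-!
Since `𝔼[x_t x_tᵀ]` obeys a matrix recursion that is polynomial in the gains (`stateCov`,
`cost_eq_sum_trace`), the objective `L ↦ 𝒢(K, L)` is smooth. Telescoping the Lyapunov solution of
`L` along the trajectories of `L'` gives the performance-difference identity `cost_sub_cost`: with
`Δ = L' - L`, `𝒢(K, L) - 𝒢(K, L')` is the sum over `t` of
`2 tr(Δ_tᵀ E_t Σ'_t) + tr(Δ_tᵀ H_t Δ_t Σ'_t)`, where `E_t` (`gradFactor`) and `H_t` (`curvature`)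
belong to `L` and `Σ'_t` is the state covariance under `L'`. It has three consequences.

* At the inner maximizer `L(K)` the Lyapunov and Riccati solutions agree and `E_t = 0`, so the gap
  `𝒢(K, L(K)) - 𝒢(K, L)` grows at least quadratically in `‖L(K) - L‖`
  (`exists_quadratic_growth`); in particular superlevel sets are bounded.
* The gradient has blocks `-2 E_t Σ_t` (`inner_gradient_cost`).
* The Lyapunov solutions are largest at `L(K)`, so the blocks `H_t` are bounded below uniformly in
  `L`. Completing the square bounds the gap by a multiple of `∑ ‖E_t‖²`, hence of the squared
  gradient norm: a global PL inequality (`exists_isPL`).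

For the gradient estimate, invariance of the uniform distribution on the sphere under reflections
gives `𝔼[U] = 0` and `𝔼[U Uᵀ] = 1 / d₁`, so by Taylor expansion its bias is `O(r)`
(`abs_integral_sphere_sub_le`); no divergence theorem on the ball is needed. The trajectory cost is
almost surely bounded, and Hoeffding's inequality in each coordinate controls the minibatch average
(`measure_gradEst_error_le`). Under the PL inequality an ascent step with a small gradient error
contracts the gap (`gap_ascent_step_le`), and a union bound over the independent steps gives the
guarantee (`runLaw_gap_le`). All iterates stay in the set of gains whose gap exceeds the initial one
by at most `1`, which is bounded, so that the constants of one ball suffice.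

The claimed distance to `L(K)` requires a final gap `f * ε` with a factor `f` that depends on the
quadratic growth constant and on `λ_min(H)`. It is reached because the constants are free: the
iteration count is large in terms of a PL constant that is taken smaller by a factor `k + 1`
(`pow_mul_gap_le`), and large `l` and `ψ` make the statistical error and the bias small.
-/

namespace ZOGame

open scoped Pointwise

/-! ### Traces of products of positive semidefinite matrices -/

section Trace

variable {ι κ : Type*} [Fintype ι] [Fintype κ]

lemma trace_mul_nonneg {M X : Matrix ι ι ℝ} (hM : M.PosSemidef) (hX : X.PosSemidef) :
    0 ≤ (M * X).trace := by
  obtain ⟨k, v, rfl⟩ := Matrix.posSemidef_iff_eq_sum_vecMulVec.mp hM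
  rw [Matrix.sum_mul, Matrix.trace_sum]
  refine Finset.sum_nonneg fun i _ => ?_
  have h := hX.dotProduct_mulVec_nonneg (v i)
  rwa [Matrix.vecMulVec_mul, Matrix.trace_vecMulVec, dotProduct_comm,
    ← Matrix.dotProduct_mulVec]

lemma posSemidef_transpose_mul_mul {M : Matrix ι ι ℝ} (hM : M.PosSemidef) (Δ : Matrix ι κ ℝ) :
    (Δᵀ * M * Δ).PosSemidef := by
  simpa using hM.conjTranspose_mul_mul_same Δ

/-- A symmetric matrix is bounded below by a multiple of the identity, positive if the matrix is
positive definite. -/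
lemma exists_smul_one_le [DecidableEq ι] {M : Matrix ι ι ℝ} (hM : M.IsHermitian) :
    ∃ s : ℝ, (M - s • (1 : Matrix ι ι ℝ)).PosSemidef ∧ (M.PosDef → 0 < s) := by
  obtain ⟨s, hs, hpos⟩ : ∃ s : ℝ, (∀ i, s ≤ hM.eigenvalues i) ∧ (M.PosDef → 0 < s) := by
    rcases isEmpty_or_nonempty ι with h | h
    · exact ⟨1, fun i => h.elim i, fun _ => one_pos⟩
    · obtain ⟨i, hi⟩ := Finite.exists_min hM.eigenvalues
      exact ⟨_, hi, fun h => h.eigenvalues_pos i⟩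
  refine ⟨s, ?_, hpos⟩
  have hH : (M - s • (1 : Matrix ι ι ℝ)).IsHermitian :=
    hM.sub (by simp [Matrix.IsHermitian])
  rw [hH.posSemidef_iff_eigenvalues_nonneg]
  intro i
  have hsp : spectrum ℝ (M - s • (1 : Matrix ι ι ℝ)) = Set.range hM.eigenvalues - ({s} : Set ℝ) := by
    rw [← Algebra.algebraMap_eq_smul_one, ← spectrum.sub_singleton_eq,
      hM.spectrum_real_eq_range_eigenvalues]
  have hi : hH.eigenvalues i ∈ Set.range hM.eigenvalues - ({s} : Set ℝ) := by
    rw [← hsp, hH.spectrum_real_eq_range_eigenvalues]; exact ⟨i, rfl⟩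
  obtain ⟨_, ⟨j, rfl⟩, _, rfl, h⟩ := hi
  have := hs j
  simp only [Pi.zero_apply]
  simp only at h
  linarith

/-- A quadratic form bounded below by `h` and a weight bounded below by `s` bound a weighted
quadratic form in `Δ` below by `h * s` times the squared Frobenius norm of `Δ`. -/
lemma le_trace_transpose_mul_mul_mul [DecidableEq ι] [DecidableEq κ] {M : Matrix ι ι ℝ}
    {X : Matrix κ κ ℝ} {h s : ℝ} (hh : 0 ≤ h) (hM : (M - h • (1 : Matrix ι ι ℝ)).PosSemidef)
    (hX : (X - s • (1 : Matrix κ κ ℝ)).PosSemidef) (hX' : X.PosSemidef) (Δ : Matrix ι κ ℝ) :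
    h * s * (Δᵀ * Δ).trace ≤ (Δᵀ * M * Δ * X).trace := by
  have h1 := trace_mul_nonneg (posSemidef_transpose_mul_mul hM Δ) hX'
  have h2 := trace_mul_nonneg (posSemidef_transpose_mul_mul Matrix.PosSemidef.one Δ) hX
  simp only [Matrix.mul_sub, Matrix.sub_mul, Matrix.trace_sub, Matrix.mul_smul, Matrix.smul_mul,
    Matrix.mul_one, Matrix.trace_smul, smul_eq_mul] at h1 h2
  nlinarith

lemma trace_transpose_mul_mul_le [DecidableEq κ] {X : Matrix κ κ ℝ} {σ : ℝ}
    (hX : (σ • (1 : Matrix κ κ ℝ) - X).PosSemidef) (E : Matrix ι κ ℝ) :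
    (Eᵀ * E * X).trace ≤ σ * (Eᵀ * E).trace := by
  classical
  have h2 := trace_mul_nonneg (posSemidef_transpose_mul_mul Matrix.PosSemidef.one E) hX
  simp only [Matrix.mul_sub, Matrix.trace_sub, Matrix.mul_smul, Matrix.mul_one, Matrix.trace_smul,
    smul_eq_mul] at h2
  linarith

/-- Completing the square in `Δ`. -/
lemma neg_two_trace_sub_trace_le [DecidableEq ι] {M : Matrix ι ι ℝ} {X : Matrix κ κ ℝ} {h : ℝ}
    (hh : 0 < h) (hM : (M - h • (1 : Matrix ι ι ℝ)).PosSemidef) (hX : X.PosSemidef)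
    (Δ E : Matrix ι κ ℝ) :
    -(2 * (Δᵀ * E * X).trace + (Δᵀ * M * Δ * X).trace) ≤ h⁻¹ * (Eᵀ * E * X).trace := by
  have h1 := trace_mul_nonneg (posSemidef_transpose_mul_mul hM Δ) hX
  have h2 := trace_mul_nonneg
    (posSemidef_transpose_mul_mul Matrix.PosSemidef.one (Δ + h⁻¹ • E)) hX
  have h3 : (Eᵀ * Δ * X).trace = (Δᵀ * E * X).trace := by
    have hX' : Xᵀ = X := by simpa using hX.isHermitian.eq
    rw [← Matrix.trace_transpose, Matrix.transpose_mul, Matrix.transpose_mul,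
      Matrix.transpose_transpose, Matrix.trace_mul_comm, hX']
  simp only [Matrix.mul_sub, Matrix.sub_mul, Matrix.trace_sub, Matrix.mul_smul, Matrix.smul_mul,
    Matrix.mul_one, Matrix.trace_smul, smul_eq_mul, Matrix.transpose_add, Matrix.transpose_smul,
    Matrix.add_mul, Matrix.mul_add, Matrix.trace_add, h3] at h1 h2
  have h4 : 0 ≤ h * ((Δᵀ * Δ * X).trace + h⁻¹ * (Δᵀ * E * X).trace
      + h⁻¹ * ((Δᵀ * E * X).trace + h⁻¹ * (Eᵀ * E * X).trace)) :=
    mul_nonneg hh.le (by linarith)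
  field_simp at h4 ⊢
  nlinarith

lemma posDef_blockDiagonal [DecidableEq κ] {M : κ → Matrix ι ι ℝ} (hM : ∀ k, (M k).PosDef) :
    (Matrix.blockDiagonal M).PosDef := by
  refine Matrix.PosDef.of_dotProduct_mulVec_pos ?_ fun {x} hx => ?_
  · rw [Matrix.IsHermitian, Matrix.blockDiagonal_conjTranspose]
    exact congrArg _ (funext fun k => (hM k).isHermitian)
  · have hmul : ∀ i k, (Matrix.blockDiagonal M *ᵥ x) (i, k) = (M k *ᵥ fun j => x (j, k)) i := by
      intro i k
      simp [Matrix.mulVec, dotProduct, Fintype.sum_prod_type, Matrix.blockDiagonal_apply]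
    have hq : star x ⬝ᵥ (Matrix.blockDiagonal M *ᵥ x)
        = ∑ k, star (fun j => x (j, k)) ⬝ᵥ (M k *ᵥ fun j => x (j, k)) := by
      simp only [dotProduct, Fintype.sum_prod_type_right, hmul, Pi.star_apply]
    rw [hq]
    obtain ⟨⟨i, k⟩, hik⟩ := Function.ne_iff.mp hx
    refine Finset.sum_pos' (fun k _ => (hM k).posSemidef.dotProduct_mulVec_nonneg _)
      ⟨k, Finset.mem_univ _, (hM k).dotProduct_mulVec_pos ?_⟩
    exact Function.ne_iff.mpr ⟨i, hik⟩

lemma lambdaMin_pos {ι : Type} [Fintype ι] [DecidableEq ι] [Nonempty ι] {M : Matrix ι ι ℝ}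
    (hM : M.PosDef) : 0 < lambdaMin M := by
  rw [lambdaMin, hM.isHermitian.spectrum_real_eq_range_eigenvalues]
  obtain ⟨i, hi⟩ := (Set.range_nonempty hM.isHermitian.eigenvalues).csInf_mem (Set.finite_range _)
  rw [← hi]
  exact hM.eigenvalues_pos i

end Trace

/-! ### Recursions -/

namespace LQGame

variable {m n d N : ℕ} (S : LQGame m n d N)

lemma state_zero (K : Gain d m N) (L : Gain n m N) (ζ : Noise m N) :
    S.state K L ζ 0 = (ζ 0).ofLp := by
  simp [state]

lemma state_succ (K : Gain d m N) (L : Gain n m N) (ζ : Noise m N) (t : Fin N) :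
    S.state K L ζ t.succ = S.closedLoop K L t *ᵥ S.state K L ζ t.castSucc + (ζ t.succ).ofLp := by
  simp [state]

lemma lyapunov_last (K : Gain d m N) (L : Gain n m N) :
    S.lyapunov K L (Fin.last N) = S.Q (Fin.last N) := by
  simp [lyapunov]

lemma lyapunov_castSucc (K : Gain d m N) (L : Gain n m N) (t : Fin N) :
    S.lyapunov K L t.castSucc = (S.closedLoop K L t)ᵀ * S.lyapunov K L t.succ * S.closedLoop K L t
      + S.Q t.castSucc + (K.mat t)ᵀ * S.Ru t * K.mat t - (L.mat t)ᵀ * S.Rw t * L.mat t := by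
  simp [lyapunov]

lemma riccati_last (K : Gain d m N) : S.riccati K (Fin.last N) = S.Q (Fin.last N) := by
  simp [riccati]

lemma riccati_castSucc (K : Gain d m N) (t : Fin N) :
    S.riccati K t.castSucc = S.Q t.castSucc + (K.mat t)ᵀ * S.Ru t * K.mat t
      + (S.A t - S.B t * K.mat t)ᵀ
        * (S.riccati K t.succ + S.riccati K t.succ * S.D t
          * (S.Rw t - (S.D t)ᵀ * S.riccati K t.succ * S.D t)⁻¹ * (S.D t)ᵀ * S.riccati K t.succ)
        * (S.A t - S.B t * K.mat t) := by
  simp [riccati]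

/-- The second-moment matrices `𝔼[x_t x_tᵀ]` of the states, defined by their recursion
`Σ_0 = C`, `Σ_{t+1} = (A_t - B_t K_t - D_t L_t) Σ_t (A_t - B_t K_t - D_t L_t)ᵀ + C`, where `C` is
the second-moment matrix of the noise. -/
noncomputable def stateCov (C : Matrix (Fin m) (Fin m) ℝ) (K : Gain d m N) (L : Gain n m N) :
    Fin (N + 1) → Matrix (Fin m) (Fin m) ℝ :=
  Fin.induction (motive := fun _ => Matrix (Fin m) (Fin m) ℝ) C
    fun t X => S.closedLoop K L t * X * (S.closedLoop K L t)ᵀ + C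

variable (C : Matrix (Fin m) (Fin m) ℝ)

lemma stateCov_zero (K : Gain d m N) (L : Gain n m N) : S.stateCov C K L 0 = C := by
  simp [stateCov]

lemma stateCov_succ (K : Gain d m N) (L : Gain n m N) (t : Fin N) :
    S.stateCov C K L t.succ
      = S.closedLoop K L t * S.stateCov C K L t.castSucc * (S.closedLoop K L t)ᵀ + C := by
  simp [stateCov]

end LQGame

/-! ### Second moments of the states -/

section Moments

variable {m n d N : ℕ} {𝒟 : Measure (EuclideanSpace ℝ (Fin m))} [IsProbabilityMeasure 𝒟] {ϑ : ℝ}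

instance : IsProbabilityMeasure (noiseLaw N 𝒟) := by
  unfold noiseLaw; infer_instance

lemma ae_norm_noise_le (hϑ : ∀ᵐ x ∂𝒟, ‖x‖ ≤ ϑ) :
    ∀ᵐ ζ ∂(noiseLaw N 𝒟), ∀ s, ‖ζ s‖ ≤ ϑ := by
  rw [ae_all_iff]
  exact fun s => (Measure.tendsto_eval_ae_ae (μ := fun _ : Fin (N + 1) => 𝒟)).eventually hϑ

lemma memLp_noise (hϑ : ∀ᵐ x ∂𝒟, ‖x‖ ≤ ϑ) (s : Fin (N + 1)) (i : Fin m) :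
    MemLp (fun ζ : Noise m N => ζ s i) 2 (noiseLaw N 𝒟) := by
  refine MemLp.of_bound (C := ϑ) ?_ ?_
  · exact Measurable.aestronglyMeasurable (by fun_prop)
  · filter_upwards [ae_norm_noise_le hϑ] with ζ hζ
    exact (PiLp.norm_apply_le (ζ s) i).trans (hζ s)

lemma integral_eval_noise (s : Fin (N + 1)) {f : EuclideanSpace ℝ (Fin m) → ℝ}
    (hf : Measurable f) : ∫ ζ, f (ζ s) ∂(noiseLaw N 𝒟) = ∫ x, f x ∂𝒟 := by
  have h := measurePreserving_eval (fun _ : Fin (N + 1) => 𝒟) s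
  have h2 := integral_map (μ := noiseLaw N 𝒟) (φ := Function.eval s) h.measurable.aemeasurable
    (f := f) hf.aestronglyMeasurable
  rw [noiseLaw, h.map_eq] at h2
  exact h2.symm

lemma integral_noise_mul_noise (hϑ : ∀ᵐ x ∂𝒟, ‖x‖ ≤ ϑ) (hmean : ∫ x, x ∂𝒟 = 0)
    (s r : Fin (N + 1)) (i k : Fin m) :
    ∫ ζ, ζ s i * ζ r k ∂(noiseLaw N 𝒟) = if s = r then secondMoment 𝒟 i k else 0 := by
  have hint : Integrable (fun x : EuclideanSpace ℝ (Fin m) => x) 𝒟 :=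
    Integrable.of_bound (by fun_prop) ϑ hϑ
  split_ifs with h
  · subst h
    exact integral_eval_noise s (f := fun x => x i * x k) (by fun_prop)
  · have hind : ProbabilityTheory.iIndepFun (fun (s : Fin (N + 1)) (ζ : Noise m N) => ζ s)
        (noiseLaw N 𝒟) :=
      ProbabilityTheory.iIndepFun_pi (μ := fun _ => 𝒟) (X := fun _ x => x)
        (fun _ => aemeasurable_id)
    have h2 := (hind.indepFun h).comp (φ := fun x => x i) (ψ := fun x => x k)
      (by fun_prop) (by fun_prop)
    have h3 := h2.integral_fun_mul_eq_mul_integral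
      (Measurable.aestronglyMeasurable (by fun_prop)) (Measurable.aestronglyMeasurable (by fun_prop))
    simp only [Function.comp_def] at h3
    rw [h3, integral_eval_noise s (f := fun x => x i) (by fun_prop)]
    have h4 : ∫ x : EuclideanSpace ℝ (Fin m), x i ∂𝒟 = 0 := by
      have := (EuclideanSpace.proj (𝕜 := ℝ) i).integral_comp_comm hint
      simpa [hmean] using this
    rw [h4, zero_mul]

lemma integrable_mul_of_memLp {Ω : Type*} [MeasurableSpace Ω] {ν : Measure Ω} {f g : Ω → ℝ}
    (hf : MemLp f 2 ν) (hg : MemLp g 2 ν) : Integrable (fun ω => f ω * g ω) ν :=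
  hf.integrable_mul hg

lemma memLp_mulVec {Ω : Type*} [MeasurableSpace Ω] {ν : Measure Ω} {p q : ℕ}
    (M : Matrix (Fin p) (Fin q) ℝ) {X : Ω → Fin q → ℝ} (hX : ∀ j, MemLp (fun ω => X ω j) 2 ν)
    (i : Fin p) : MemLp (fun ω => (M *ᵥ X ω) i) 2 ν := by
  simp only [Matrix.mulVec, dotProduct]
  exact memLp_finsetSum _ fun j _ => (hX j).const_mul _

lemma integral_mulVec_mul {Ω : Type*} [MeasurableSpace Ω] {ν : Measure Ω} {p q : ℕ}
    (M : Matrix (Fin p) (Fin q) ℝ) {X : Ω → Fin q → ℝ} {Y : Ω → ℝ}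
    (hX : ∀ j, Integrable (fun ω => X ω j * Y ω) ν) (i : Fin p) :
    ∫ ω, (M *ᵥ X ω) i * Y ω ∂ν = ∑ j, M i j * ∫ ω, X ω j * Y ω ∂ν := by
  simp only [Matrix.mulVec, dotProduct, Finset.sum_mul, mul_assoc]
  rw [integral_finsetSum _ fun j _ => (hX j).const_mul _]
  simp only [integral_const_mul]

variable (S : LQGame m n d N) (K : Gain d m N) (L : Gain n m N)

lemma memLp_state (hϑ : ∀ᵐ x ∂𝒟, ‖x‖ ≤ ϑ) (t : Fin (N + 1)) :
    ∀ i, MemLp (fun ζ : Noise m N => S.state K L ζ t i) 2 (noiseLaw N 𝒟) := by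
  induction t using Fin.induction with
  | zero => intro i; simpa only [S.state_zero] using memLp_noise hϑ 0 i
  | succ t ih =>
    intro i
    simp only [S.state_succ, Pi.add_apply]
    exact (memLp_mulVec _ ih i).add (memLp_noise hϑ _ i)

/-- The state at time `t` is uncorrelated with later noises. -/
lemma integral_state_mul_noise (hϑ : ∀ᵐ x ∂𝒟, ‖x‖ ≤ ϑ) (hmean : ∫ x, x ∂𝒟 = 0)
    (t : Fin (N + 1)) : ∀ (s : Fin (N + 1)), t < s → ∀ i k,
      ∫ ζ, S.state K L ζ t i * ζ s k ∂(noiseLaw N 𝒟) = 0 := by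
  induction t using Fin.induction with
  | zero =>
    intro s hs i k
    simp only [S.state_zero]
    rw [integral_noise_mul_noise hϑ hmean, if_neg hs.ne]
  | succ t ih =>
    intro s hs i k
    have hL := memLp_state S K L hϑ t.castSucc (𝒟 := 𝒟)
    have hN := memLp_noise (N := N) hϑ
    simp only [S.state_succ, Pi.add_apply, add_mul]
    rw [integral_add (integrable_mul_of_memLp (memLp_mulVec _ hL i) (hN s k))
      (integrable_mul_of_memLp (hN _ i) (hN s k)),
      integral_mulVec_mul _ (fun j => integrable_mul_of_memLp (hL j) (hN s k)),
      integral_noise_mul_noise hϑ hmean, if_neg hs.ne]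
    simp [ih s (t.castSucc_lt_succ.trans hs)]

lemma integral_state_mul_state (hϑ : ∀ᵐ x ∂𝒟, ‖x‖ ≤ ϑ) (hmean : ∫ x, x ∂𝒟 = 0)
    (t : Fin (N + 1)) : ∀ i k, ∫ ζ, S.state K L ζ t i * S.state K L ζ t k ∂(noiseLaw N 𝒟)
      = S.stateCov (secondMoment 𝒟) K L t i k := by
  induction t using Fin.induction with
  | zero =>
    intro i k
    simp only [S.state_zero, S.stateCov_zero]
    rw [integral_noise_mul_noise hϑ hmean, if_pos rfl]
  | succ t ih =>
    intro i k
    have hL := memLp_state S K L hϑ t.castSucc (𝒟 := 𝒟)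
    have hN := memLp_noise (N := N) hϑ t.succ
    have hMx := memLp_mulVec (S.closedLoop K L t) hL
    have hcross : ∀ i k, ∫ ζ : Noise m N, (S.closedLoop K L t *ᵥ S.state K L ζ t.castSucc) i
        * ζ t.succ k ∂(noiseLaw N 𝒟) = 0 := fun i k => by
      rw [integral_mulVec_mul _ (fun j => integrable_mul_of_memLp (hL j) (hN k))]
      simp [integral_state_mul_noise S K L hϑ hmean t.castSucc t.succ t.castSucc_lt_succ]
    have hquad : ∫ ζ : Noise m N, (S.closedLoop K L t *ᵥ S.state K L ζ t.castSucc) i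
        * (S.closedLoop K L t *ᵥ S.state K L ζ t.castSucc) k ∂(noiseLaw N 𝒟)
        = (S.closedLoop K L t * S.stateCov (secondMoment 𝒟) K L t.castSucc
          * (S.closedLoop K L t)ᵀ) i k := by
      rw [integral_mulVec_mul _ (fun j => integrable_mul_of_memLp (hL j) (hMx k)),
        Matrix.mul_assoc, Matrix.mul_apply]
      refine Finset.sum_congr rfl fun j _ => ?_
      congr 1
      simp only [mul_comm (S.state K L _ t.castSucc j)]
      rw [integral_mulVec_mul _ (fun l => integrable_mul_of_memLp (hL l) (hL j)),
        Matrix.mul_apply]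
      refine Finset.sum_congr rfl fun l _ => ?_
      rw [← ih, Matrix.transpose_apply, mul_comm]
      simp only [mul_comm]
    simp only [S.state_succ, Pi.add_apply, S.stateCov_succ, Matrix.add_apply]
    have hexp : ∀ ζ : Noise m N,
        ((S.closedLoop K L t *ᵥ S.state K L ζ t.castSucc) i + ζ t.succ i)
          * ((S.closedLoop K L t *ᵥ S.state K L ζ t.castSucc) k + ζ t.succ k)
        = (S.closedLoop K L t *ᵥ S.state K L ζ t.castSucc) i
            * (S.closedLoop K L t *ᵥ S.state K L ζ t.castSucc) k
          + (S.closedLoop K L t *ᵥ S.state K L ζ t.castSucc) i * ζ t.succ k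
          + (S.closedLoop K L t *ᵥ S.state K L ζ t.castSucc) k * ζ t.succ i
          + ζ t.succ i * ζ t.succ k := fun ζ => by ring
    simp only [hexp]
    have h1 := integrable_mul_of_memLp (hMx i) (hMx k)
    have h2 := integrable_mul_of_memLp (hMx i) (hN k)
    have h3 := integrable_mul_of_memLp (hMx k) (hN i)
    have h4 := integrable_mul_of_memLp (hN i) (hN k)
    rw [integral_add (by exact (h1.add h2).add h3) h4,
      integral_add (by exact h1.add h2) h3, integral_add h1 h2,
      hquad, hcross, hcross, integral_noise_mul_noise hϑ hmean, if_pos rfl, add_zero, add_zero]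

/-- The expectation of a quadratic form of the state. -/
lemma integral_quadForm_state (hϑ : ∀ᵐ x ∂𝒟, ‖x‖ ≤ ϑ) (hmean : ∫ x, x ∂𝒟 = 0)
    (t : Fin (N + 1)) (M : Matrix (Fin m) (Fin m) ℝ) :
    Integrable (fun ζ => S.state K L ζ t ⬝ᵥ (M *ᵥ S.state K L ζ t)) (noiseLaw N 𝒟) ∧
    ∫ ζ, S.state K L ζ t ⬝ᵥ (M *ᵥ S.state K L ζ t) ∂(noiseLaw N 𝒟)
      = (M * S.stateCov (secondMoment 𝒟) K L t).trace := by
  have hL := memLp_state S K L hϑ t (𝒟 := 𝒟)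
  have hI : ∀ i, Integrable (fun ζ => (M *ᵥ S.state K L ζ t) i * S.state K L ζ t i)
      (noiseLaw N 𝒟) := fun i => integrable_mul_of_memLp (memLp_mulVec M hL i) (hL i)
  simp only [dotProduct_comm (S.state K L _ t)]
  simp only [dotProduct]
  refine ⟨integrable_finsetSum _ fun i _ => hI i, ?_⟩
  rw [integral_finsetSum _ fun i _ => hI i, Matrix.trace]
  refine Finset.sum_congr rfl fun i _ => ?_
  rw [integral_mulVec_mul _ (fun j => integrable_mul_of_memLp (hL j) (hL i)), Matrix.diag_apply,
    Matrix.mul_apply]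
  simp only [integral_state_mul_state S K L hϑ hmean]

/-- The expected cost in terms of the second moments of the states. -/
lemma cost_eq_sum_trace (hϑ : ∀ᵐ x ∂𝒟, ‖x‖ ≤ ϑ) (hmean : ∫ x, x ∂𝒟 = 0) :
    S.cost 𝒟 K L = (∑ t : Fin N, ((S.Q t.castSucc + (K.mat t)ᵀ * S.Ru t * K.mat t
        - (L.mat t)ᵀ * S.Rw t * L.mat t)
        * S.stateCov (secondMoment 𝒟) K L t.castSucc).trace)
      + (S.Q (Fin.last N) * S.stateCov (secondMoment 𝒟) K L (Fin.last N)).trace := by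
  have hq : ∀ {p : ℕ} (B : Matrix (Fin p) (Fin m) ℝ) (R : Matrix (Fin p) (Fin p) ℝ)
      (x : Fin m → ℝ), -(B *ᵥ x) ⬝ᵥ (R *ᵥ -(B *ᵥ x)) = x ⬝ᵥ ((Bᵀ * R * B) *ᵥ x) := by
    intro p B R x
    rw [Matrix.mulVec_neg, neg_dotProduct_neg, ← Matrix.mulVec_mulVec, ← Matrix.mulVec_mulVec,
      Matrix.dotProduct_mulVec x, Matrix.vecMul_transpose]
  have hr : ∀ ζ, S.rolloutCost K L ζ = (∑ t : Fin N, S.state K L ζ t.castSucc ⬝ᵥ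
      ((S.Q t.castSucc + (K.mat t)ᵀ * S.Ru t * K.mat t - (L.mat t)ᵀ * S.Rw t * L.mat t) *ᵥ
        S.state K L ζ t.castSucc))
      + S.state K L ζ (Fin.last N) ⬝ᵥ (S.Q (Fin.last N) *ᵥ S.state K L ζ (Fin.last N)) := by
    intro ζ
    simp only [LQGame.rolloutCost, hq, Matrix.sub_mulVec, Matrix.add_mulVec, dotProduct_sub,
      dotProduct_add]
  have hI := fun t => integral_quadForm_state S K L hϑ hmean t
  simp only [LQGame.cost, hr]
  rw [integral_add (integrable_finsetSum _ fun t _ => (hI _ _).1) (hI _ _).1,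
    integral_finsetSum _ fun t _ => (hI _ _).1, (hI _ _).2]
  simp only [(hI _ _).2]

end Moments

/-! ### Smoothness of the objective -/

section Smooth

variable {E : Type*} [NormedAddCommGroup E] [NormedSpace ℝ E]
variable {ι κ τ : Type*}

/-- A matrix-valued map all of whose entries are twice continuously differentiable. (There is no
canonical norm on matrices, hence the entrywise formulation.) -/
def EntrySmooth (F : E → Matrix ι κ ℝ) : Prop := ∀ i j, ContDiff ℝ 2 fun x => F x i j

lemma EntrySmooth.const (M : Matrix ι κ ℝ) : EntrySmooth fun _ : E => M :=
  fun _ _ => contDiff_const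

lemma EntrySmooth.add {F G : E → Matrix ι κ ℝ} (hF : EntrySmooth F) (hG : EntrySmooth G) :
    EntrySmooth fun x => F x + G x := fun i j => (hF i j).add (hG i j)

lemma EntrySmooth.sub {F G : E → Matrix ι κ ℝ} (hF : EntrySmooth F) (hG : EntrySmooth G) :
    EntrySmooth fun x => F x - G x := fun i j => (hF i j).sub (hG i j)

lemma EntrySmooth.transpose {F : E → Matrix ι κ ℝ} (hF : EntrySmooth F) :
    EntrySmooth fun x => (F x)ᵀ := fun i j => hF j i

lemma EntrySmooth.mul [Fintype κ] {F : E → Matrix ι κ ℝ} {G : E → Matrix κ τ ℝ} (hF : EntrySmooth F)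
    (hG : EntrySmooth G) : EntrySmooth fun x => F x * G x := fun i j => by
  simp only [Matrix.mul_apply]
  exact ContDiff.sum fun k _ => (hF i k).mul (hG k j)

lemma EntrySmooth.trace [Fintype ι] {F : E → Matrix ι ι ℝ} (hF : EntrySmooth F) :
    ContDiff ℝ 2 fun x => (F x).trace := by
  simp only [Matrix.trace, Matrix.diag_apply]
  exact ContDiff.sum fun k _ => hF k k

end Smooth

section Deterministic

variable {m n d N : ℕ} (S : LQGame m n d N) (C : Matrix (Fin m) (Fin m) ℝ)
  (K : Gain d m N) (L L' : Gain n m N)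

lemma entrySmooth_mat (t : Fin N) : EntrySmooth fun L : Gain n m N => L.mat t :=
  fun i j => (EuclideanSpace.proj (𝕜 := ℝ) (t, i, j)).contDiff

lemma entrySmooth_closedLoop (t : Fin N) :
    EntrySmooth fun L : Gain n m N => S.closedLoop K L t :=
  (EntrySmooth.const _).sub ((EntrySmooth.const _).mul (entrySmooth_mat t))

lemma entrySmooth_stateCov (t : Fin (N + 1)) :
    EntrySmooth fun L : Gain n m N => S.stateCov C K L t := by
  induction t using Fin.induction with
  | zero => simpa only [S.stateCov_zero] using EntrySmooth.const C
  | succ t ih =>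
    simp only [S.stateCov_succ]
    exact (((entrySmooth_closedLoop S K t).mul ih).mul
      (entrySmooth_closedLoop S K t).transpose).add (.const C)

lemma contDiff_cost {𝒟 : Measure (EuclideanSpace ℝ (Fin m))} [IsProbabilityMeasure 𝒟] {ϑ : ℝ}
    (hϑ : ∀ᵐ x ∂𝒟, ‖x‖ ≤ ϑ) (hmean : ∫ x, x ∂𝒟 = 0) :
    ContDiff ℝ 2 (S.cost 𝒟 K : Gain n m N → ℝ) := by
  have h : (S.cost 𝒟 K : Gain n m N → ℝ) = fun L => _ :=
    funext fun L => cost_eq_sum_trace S K L hϑ hmean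
  rw [h]
  refine ContDiff.add (ContDiff.sum fun t _ => ?_)
    ((EntrySmooth.const _).mul (entrySmooth_stateCov S _ K _)).trace
  exact ((((EntrySmooth.const _).sub (((entrySmooth_mat t).transpose.mul (.const _)).mul
    (entrySmooth_mat t))).mul (entrySmooth_stateCov S _ K _))).trace

/-! ### The performance-difference identity -/

lemma posSemidef_stateCov_sub (hC : C.PosSemidef) (t : Fin (N + 1)) :
    (S.stateCov C K L t - C).PosSemidef := by
  induction t using Fin.induction with
  | zero => simpa only [S.stateCov_zero, sub_self] using Matrix.PosSemidef.zero
  | succ t ih =>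
    rw [S.stateCov_succ, add_sub_cancel_right]
    have h := ih.add hC
    rw [sub_add_cancel] at h
    simpa using h.mul_mul_conjTranspose_same (S.closedLoop K L t)

lemma posSemidef_stateCov (hC : C.PosSemidef) (t : Fin (N + 1)) :
    (S.stateCov C K L t).PosSemidef := by
  have h := (posSemidef_stateCov_sub S C K L hC t).add hC
  rwa [sub_add_cancel] at h

lemma transpose_Q (t : Fin (N + 1)) : (S.Q t)ᵀ = S.Q t := by
  simpa using (S.Q_posSemidef t).isHermitian.eq

lemma transpose_Ru (t : Fin N) : (S.Ru t)ᵀ = S.Ru t := by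
  simpa using (S.Ru_posDef t).isHermitian.eq

lemma transpose_Rw (t : Fin N) : (S.Rw t)ᵀ = S.Rw t := by
  simpa using (S.Rw_posDef t).isHermitian.eq

lemma transpose_lyapunov (t : Fin (N + 1)) : (S.lyapunov K L t)ᵀ = S.lyapunov K L t := by
  induction t using Fin.reverseInduction with
  | last => rw [S.lyapunov_last, transpose_Q]
  | cast t ih =>
    simp only [S.lyapunov_castSucc, Matrix.transpose_add, Matrix.transpose_sub,
      Matrix.transpose_mul, Matrix.transpose_transpose, ih, transpose_Q, transpose_Ru,
      transpose_Rw, Matrix.mul_assoc]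

/-- The matrix `E_t = R^w_t L_t + D_tᵀ P_{K_{t+1}, L_{t+1}} (A_t - B_t K_t - D_t L_t)`. The block of
`∇_L 𝒢(K, L)` at time `t` is `-2 E_t 𝔼[x_t x_tᵀ]`. -/
noncomputable def gradFactor (t : Fin N) : Matrix (Fin n) (Fin m) ℝ :=
  S.Rw t * L.mat t + (S.D t)ᵀ * S.lyapunov K L t.succ * S.closedLoop K L t

/-- The block `R^w_t - D_tᵀ P_{K_{t+1}, L_{t+1}} D_t` of `H_{K, L}`. -/
noncomputable def curvature (t : Fin N) : Matrix (Fin n) (Fin n) ℝ :=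
  S.Rw t - (S.D t)ᵀ * S.lyapunov K L t.succ * S.D t

lemma closedLoop_eq_sub (t : Fin N) :
    S.closedLoop K L' t = S.closedLoop K L t - S.D t * (L'.mat t - L.mat t) := by
  simp only [LQGame.closedLoop, Matrix.mul_sub]
  abel

/-- The loss of using `L'` for one step and `L` afterwards. -/
lemma lyapunov_step (t : Fin N) :
    S.Q t.castSucc + (K.mat t)ᵀ * S.Ru t * K.mat t - (L'.mat t)ᵀ * S.Rw t * L'.mat t
      = S.lyapunov K L t.castSucc
        - (S.closedLoop K L' t)ᵀ * S.lyapunov K L t.succ * S.closedLoop K L' t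
        - ((L'.mat t - L.mat t)ᵀ * gradFactor S K L t
          + (gradFactor S K L t)ᵀ * (L'.mat t - L.mat t)
          + (L'.mat t - L.mat t)ᵀ * curvature S K L t * (L'.mat t - L.mat t)) := by
  obtain ⟨Δ, hΔ⟩ : ∃ Δ, L'.mat t = L.mat t + Δ := ⟨L'.mat t - L.mat t, by abel⟩
  rw [closedLoop_eq_sub S K L L' t, S.lyapunov_castSucc, hΔ, add_sub_cancel_left]
  simp only [gradFactor, curvature, Matrix.transpose_add, Matrix.transpose_sub,
    Matrix.transpose_mul, Matrix.transpose_transpose, transpose_lyapunov, transpose_Rw,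
    Matrix.mul_add, Matrix.add_mul, Matrix.mul_sub, Matrix.sub_mul, Matrix.mul_assoc]
  abel

lemma sum_castSucc_sub_succ {f : Fin (N + 1) → ℝ} :
    ∑ t : Fin N, (f t.castSucc - f t.succ) = f 0 - f (Fin.last N) := by
  have h1 := Fin.sum_univ_succ f
  have h2 := Fin.sum_univ_castSucc f
  rw [Finset.sum_sub_distrib]
  linarith

lemma trace_transpose_mul_mul_comm {ι κ : Type*} [Fintype ι] [Fintype κ] {X : Matrix κ κ ℝ}
    (hX : Xᵀ = X) (Δ E : Matrix ι κ ℝ) : (Eᵀ * Δ * X).trace = (Δᵀ * E * X).trace := by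
  rw [← Matrix.trace_transpose, Matrix.transpose_mul, Matrix.transpose_mul,
    Matrix.transpose_transpose, Matrix.trace_mul_comm, hX]

/-- The decrease `𝒢(K, L) - 𝒢(K, L')` as an expectation along the trajectories of `L'`. -/
noncomputable def gainLoss : ℝ := ∑ t : Fin N,
  (2 * ((L'.mat t - L.mat t)ᵀ * gradFactor S K L t * S.stateCov C K L' t.castSucc).trace
    + ((L'.mat t - L.mat t)ᵀ * curvature S K L t * (L'.mat t - L.mat t)
      * S.stateCov C K L' t.castSucc).trace)

variable {𝒟 : Measure (EuclideanSpace ℝ (Fin m))} [IsProbabilityMeasure 𝒟] {ϑ : ℝ}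

lemma cost_eq_trace_lyapunov (hϑ : ∀ᵐ x ∂𝒟, ‖x‖ ≤ ϑ) (hmean : ∫ x, x ∂𝒟 = 0)
    (hC : (secondMoment 𝒟).PosSemidef) :
    S.cost 𝒟 K L' = (S.lyapunov K L 0 * secondMoment 𝒟).trace
      + (∑ t : Fin N, (S.lyapunov K L t.succ * secondMoment 𝒟).trace)
      - gainLoss S (secondMoment 𝒟) K L L' := by
  set C := secondMoment 𝒟
  set f : Fin (N + 1) → ℝ := fun t => (S.lyapunov K L t * S.stateCov C K L' t).trace with hf
  have hstep : ∀ t : Fin N, ((S.Q t.castSucc + (K.mat t)ᵀ * S.Ru t * K.mat t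
        - (L'.mat t)ᵀ * S.Rw t * L'.mat t) * S.stateCov C K L' t.castSucc).trace
      = (f t.castSucc - f t.succ) + (S.lyapunov K L t.succ * C).trace
        - (2 * ((L'.mat t - L.mat t)ᵀ * gradFactor S K L t * S.stateCov C K L' t.castSucc).trace
          + ((L'.mat t - L.mat t)ᵀ * curvature S K L t * (L'.mat t - L.mat t)
            * S.stateCov C K L' t.castSucc).trace) := by
    intro t
    have hsymm : (S.stateCov C K L' t.castSucc)ᵀ = S.stateCov C K L' t.castSucc := by
      simpa using (posSemidef_stateCov S C K L' hC t.castSucc).isHermitian.eq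
    have h1 : ((S.closedLoop K L' t)ᵀ * S.lyapunov K L t.succ * S.closedLoop K L' t
        * S.stateCov C K L' t.castSucc).trace
        = f t.succ - (S.lyapunov K L t.succ * C).trace := by
      simp only [hf, S.stateCov_succ, Matrix.mul_add, Matrix.trace_add, add_sub_cancel_right]
      rw [Matrix.mul_assoc, Matrix.mul_assoc, Matrix.trace_mul_comm]
      simp only [Matrix.mul_assoc]
    rw [lyapunov_step S K L L' t]
    simp only [Matrix.sub_mul, Matrix.add_mul, Matrix.trace_sub, Matrix.trace_add]
      at h1 ⊢
    have h2 := trace_transpose_mul_mul_comm hsymm (L'.mat t - L.mat t) (gradFactor S K L t)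
    simp only [Matrix.mul_sub, Matrix.sub_mul, Matrix.trace_sub, Matrix.transpose_sub] at h1 h2 ⊢
    rw [h1]
    linarith
  rw [cost_eq_sum_trace S K L' hϑ hmean, Finset.sum_congr rfl fun t _ => hstep t,
    Finset.sum_sub_distrib, Finset.sum_add_distrib, sum_castSucc_sub_succ, ← S.lyapunov_last K L,
    gainLoss]
  simp only [hf, S.stateCov_zero]
  ring

/-- The performance-difference identity. -/
lemma cost_sub_cost (hϑ : ∀ᵐ x ∂𝒟, ‖x‖ ≤ ϑ) (hmean : ∫ x, x ∂𝒟 = 0)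
    (hC : (secondMoment 𝒟).PosSemidef) :
    S.cost 𝒟 K L - S.cost 𝒟 K L' = gainLoss S (secondMoment 𝒟) K L L' := by
  rw [cost_eq_trace_lyapunov S K L L' hϑ hmean hC, cost_eq_trace_lyapunov S K L L hϑ hmean hC]
  have : gainLoss S (secondMoment 𝒟) K L L = 0 := by simp [gainLoss]
  rw [this]
  ring

/-! ### The inner maximizer -/

variable {K}

lemma innerSol_mat (hK : K ∈ S.feasible) (t : Fin N) : (S.innerSol K).mat t
    = -((S.Rw t - (S.D t)ᵀ * S.riccati K t.succ * S.D t)⁻¹ * ((S.D t)ᵀ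
    * S.riccati K t.succ * (S.A t - S.B t * K.mat t))) := by
  have h : (S.innerSol K).mat t = (-S.Rw t + (S.D t)ᵀ * S.riccati K t.succ * S.D t)⁻¹ * (S.D t)ᵀ
    * S.riccati K t.succ * (S.A t - S.B t * K.mat t) := rfl
  have h2 : (-S.Rw t + (S.D t)ᵀ * S.riccati K t.succ * S.D t)⁻¹
      = -(S.Rw t - (S.D t)ᵀ * S.riccati K t.succ * S.D t)⁻¹ := by
    refine Matrix.inv_eq_left_inv ?_
    have := Matrix.nonsing_inv_mul _ ((Matrix.isUnit_iff_isUnit_det _).mp (hK.2 t).isUnit)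
    rw [← this, Matrix.neg_mul, ← Matrix.mul_neg]
    congr 1
    abel
  rw [h, h2]
  simp only [Matrix.neg_mul, Matrix.mul_assoc]

/-- The stationarity equation of the inner maximization problem. -/
lemma rw_mul_innerSol (hK : K ∈ S.feasible) (t : Fin N) :
    S.Rw t * (S.innerSol K).mat t
      + (S.D t)ᵀ * S.riccati K t.succ * S.closedLoop K (S.innerSol K) t = 0 := by
  have h1 : (S.Rw t - (S.D t)ᵀ * S.riccati K t.succ * S.D t) * (S.innerSol K).mat t
      = -((S.D t)ᵀ * S.riccati K t.succ * (S.A t - S.B t * K.mat t)) := by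
    rw [innerSol_mat S hK, Matrix.mul_neg, Matrix.mul_nonsing_inv_cancel_left _ _
      ((Matrix.isUnit_iff_isUnit_det _).mp (hK.2 t).isUnit)]
  rw [LQGame.closedLoop, Matrix.mul_sub ((S.D t)ᵀ * S.riccati K t.succ), ← neg_eq_iff_eq_neg.mpr h1,
    Matrix.sub_mul]
  simp only [Matrix.mul_assoc]
  abel

/-- Along the inner maximizer the Lyapunov solution is the Riccati solution. -/
lemma lyapunov_innerSol (hK : K ∈ S.feasible) (t : Fin (N + 1)) :
    S.lyapunov K (S.innerSol K) t = S.riccati K t := by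
  induction t using Fin.reverseInduction with
  | last => rw [S.lyapunov_last, S.riccati_last]
  | cast t ih =>
    have hst := rw_mul_innerSol S hK t
    have hsol := innerSol_mat S hK t
    rw [S.lyapunov_castSucc, S.riccati_castSucc, ih]
    set P := S.riccati K t.succ
    set L := (S.innerSol K).mat t
    set M := S.A t - S.B t * K.mat t
    have hcl : S.closedLoop K (S.innerSol K) t = M - S.D t * L := rfl
    rw [hcl] at hst ⊢
    have h1 : (M - S.D t * L)ᵀ * P * (M - S.D t * L)
        = Mᵀ * P * M - Mᵀ * P * S.D t * L - Lᵀ * ((S.D t)ᵀ * P * (M - S.D t * L)) := by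
      simp only [Matrix.transpose_sub, Matrix.transpose_mul, Matrix.sub_mul, Matrix.mul_sub,
        Matrix.mul_assoc]
      abel
    have h2 : (S.D t)ᵀ * P * (M - S.D t * L) = -(S.Rw t * L) := by
      rw [eq_neg_iff_add_eq_zero, add_comm]; exact hst
    rw [h1, h2, hsol]
    simp only [Matrix.mul_add, Matrix.add_mul, Matrix.mul_neg, Matrix.neg_mul, Matrix.mul_assoc,
      Matrix.transpose_neg]
    abel

lemma gradFactor_innerSol (hK : K ∈ S.feasible) (t : Fin N) :
    gradFactor S K (S.innerSol K) t = 0 := by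
  rw [gradFactor, lyapunov_innerSol S hK, rw_mul_innerSol S hK]

lemma posDef_curvature_innerSol (hK : K ∈ S.feasible) (t : Fin N) :
    (curvature S K (S.innerSol K) t).PosDef := by
  rw [curvature, lyapunov_innerSol S hK]
  exact hK.2 t

/-- Among all Lyapunov solutions, the one along the inner maximizer is the largest. -/
lemma posSemidef_lyapunov_sub (hK : K ∈ S.feasible) (t : Fin (N + 1)) :
    (S.lyapunov K (S.innerSol K) t - S.lyapunov K L t).PosSemidef := by
  induction t using Fin.reverseInduction with
  | last => rw [S.lyapunov_last, S.lyapunov_last, sub_self]; exact .zero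
  | cast t ih =>
    have h := lyapunov_step S K (S.innerSol K) L t
    rw [gradFactor_innerSol S hK] at h
    have h2 : S.lyapunov K (S.innerSol K) t.castSucc - S.lyapunov K L t.castSucc
        = (S.closedLoop K L t)ᵀ * (S.lyapunov K (S.innerSol K) t.succ - S.lyapunov K L t.succ)
          * S.closedLoop K L t
        + (L.mat t - (S.innerSol K).mat t)ᵀ * curvature S K (S.innerSol K) t
          * (L.mat t - (S.innerSol K).mat t) := by
      rw [S.lyapunov_castSucc K L, add_assoc, add_sub_assoc, h]
      simp only [Matrix.mul_sub ((S.closedLoop K L t)ᵀ), Matrix.sub_mul _ _ (S.closedLoop K L t),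
        Matrix.mul_zero, Matrix.zero_mul, Matrix.transpose_zero]
      abel
    rw [h2]
    exact (posSemidef_transpose_mul_mul ih _).add
      (posSemidef_transpose_mul_mul (posDef_curvature_innerSol S hK t).posSemidef _)

/-- The curvature blocks are smallest at the inner maximizer, hence bounded below uniformly
in `L`. -/
lemma exists_curvature_bound (hN : 0 < N) (hK : K ∈ S.feasible) :
    ∃ h : ℝ, 0 < h ∧ ∀ (L : Gain n m N) (t : Fin N),
      (curvature S K L t - h • (1 : Matrix (Fin n) (Fin n) ℝ)).PosSemidef := by
  have : Nonempty (Fin N) := ⟨⟨0, hN⟩⟩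
  choose s hs hpos using fun t => exists_smul_one_le (posDef_curvature_innerSol S hK t).isHermitian
  obtain ⟨t₀, ht₀⟩ := Finite.exists_min s
  refine ⟨s t₀, hpos t₀ (posDef_curvature_innerSol S hK t₀), fun L t => ?_⟩
  have h : curvature S K L t - s t₀ • (1 : Matrix (Fin n) (Fin n) ℝ)
      = (curvature S K (S.innerSol K) t - s t • (1 : Matrix (Fin n) (Fin n) ℝ))
        + (s t - s t₀) • (1 : Matrix (Fin n) (Fin n) ℝ)
        + (S.D t)ᵀ * (S.lyapunov K (S.innerSol K) t.succ - S.lyapunov K L t.succ) * S.D t := by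
    simp only [curvature, sub_smul, Matrix.mul_sub, Matrix.sub_mul]
    abel
  rw [h]
  exact ((hs t).add (Matrix.PosSemidef.one.smul (sub_nonneg.mpr (ht₀ t)))).add
    (posSemidef_transpose_mul_mul (posSemidef_lyapunov_sub S L hK _) _)

/-! ### Quadratic growth and the PL inequality -/

lemma inner_eq_sum_trace (L L' : Gain n m N) :
    inner ℝ L L' = ∑ t, ((L.mat t)ᵀ * L'.mat t).trace := by
  simp only [PiLp.inner_apply, Fintype.sum_prod_type, Matrix.trace, Matrix.diag_apply,
    Matrix.mul_apply, Matrix.transpose_apply, Gain.mat, Matrix.of_apply]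
  refine Finset.sum_congr rfl fun t _ => ?_
  rw [Finset.sum_comm]
  simp [mul_comm]

lemma norm_sq_eq_sum_trace (L : Gain n m N) : ‖L‖ ^ 2 = ∑ t, ((L.mat t)ᵀ * L.mat t).trace := by
  rw [← real_inner_self_eq_norm_sq, inner_eq_sum_trace]

lemma mat_sub (t : Fin N) : (L' - L).mat t = L'.mat t - L.mat t := rfl

lemma mat_ofMat (E : Fin N → Matrix (Fin n) (Fin m) ℝ) (t : Fin N) :
    (Gain.ofMat E).mat t = E t := rfl

/-- Quadratic growth: the optimality gap controls the squared distance to the maximizer. -/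
lemma exists_quadratic_growth (hN : 0 < N) (hϑ : ∀ᵐ x ∂𝒟, ‖x‖ ≤ ϑ) (hmean : ∫ x, x ∂𝒟 = 0)
    (hcov : (secondMoment 𝒟).PosDef) (hK : K ∈ S.feasible) :
    ∃ κ : ℝ, 0 < κ ∧ ∀ L : Gain n m N,
      κ * ‖S.innerSol K - L‖ ^ 2 ≤ S.cost 𝒟 K (S.innerSol K) - S.cost 𝒟 K L := by
  obtain ⟨h, hpos, hh⟩ := exists_curvature_bound S hN hK
  obtain ⟨s, hs, hspos⟩ := exists_smul_one_le hcov.isHermitian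
  refine ⟨h * s, mul_pos hpos (hspos hcov), fun L => ?_⟩
  rw [cost_sub_cost S K _ _ hϑ hmean hcov.posSemidef, norm_sub_rev, norm_sq_eq_sum_trace,
    gainLoss, Finset.mul_sum]
  refine Finset.sum_le_sum fun t _ => ?_
  rw [gradFactor_innerSol S hK, mat_sub]
  simp only [Matrix.mul_zero, Matrix.zero_mul, Matrix.trace_zero, mul_zero, zero_add]
  refine le_trace_transpose_mul_mul_mul hpos.le (hh _ t) ?_
    (posSemidef_stateCov S _ K L hcov.posSemidef _) _
  have := (posSemidef_stateCov_sub S _ K L hcov.posSemidef t.castSucc).add hs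
  rwa [sub_add_sub_cancel] at this

/-- The derivative of the objective. -/
lemma inner_gradient_cost (hϑ : ∀ᵐ x ∂𝒟, ‖x‖ ≤ ϑ) (hmean : ∫ x, x ∂𝒟 = 0)
    (hC : (secondMoment 𝒟).PosSemidef) (L V : Gain n m N) :
    inner ℝ (gradient (S.cost 𝒟 K) L) V = -∑ t : Fin N,
      2 * ((V.mat t)ᵀ * gradFactor S K L t
        * S.stateCov (secondMoment 𝒟) K L t.castSucc).trace := by
  set C := secondMoment 𝒟
  have hd : DifferentiableAt ℝ (S.cost 𝒟 K : Gain n m N → ℝ) L :=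
    (contDiff_cost S K hϑ hmean).differentiable (by norm_num) L
  have h1 : HasDerivAt (fun τ : ℝ => S.cost 𝒟 K (L + τ • V))
      (inner ℝ (gradient (S.cost 𝒟 K) L) V) 0 := by
    have hg := hd.hasGradientAt.hasFDerivAt
    have hl : HasDerivAt (fun τ : ℝ => L + τ • V) V 0 := by
      simpa using ((hasDerivAt_id (0 : ℝ)).smul_const V).const_add L
    have h0 : L = L + (0 : ℝ) • V := by simp
    rw [h0] at hg
    have := hg.comp_hasDerivAt (0 : ℝ) hl
    simpa [Function.comp_def] using this
  have hline : Continuous fun τ : ℝ => L + τ • V := by fun_prop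
  have hcov : ∀ t, EntrySmooth fun X : Gain n m N => S.stateCov C K X t :=
    entrySmooth_stateCov S C K
  set φ : ℝ → ℝ := fun τ => -∑ t : Fin N,
    (2 * ((V.mat t)ᵀ * gradFactor S K L t * S.stateCov C K (L + τ • V) t.castSucc).trace
      + τ * ((V.mat t)ᵀ * curvature S K L t * V.mat t
        * S.stateCov C K (L + τ • V) t.castSucc).trace) with hφ
  have hφc : Continuous φ := by
    refine (continuous_finsetSum _ fun t _ => ?_).neg
    exact (((((EntrySmooth.const _).mul (hcov _)).trace.continuous.comp hline)).const_mul 2).add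
      (continuous_id.mul (((EntrySmooth.const _).mul (hcov _)).trace.continuous.comp hline))
  have hexp : ∀ τ : ℝ, S.cost 𝒟 K (L + τ • V) = S.cost 𝒟 K L + τ * φ τ := by
    intro τ
    have h := cost_sub_cost S K L (L + τ • V) hϑ hmean hC
    have hmat : ∀ t, (L + τ • V).mat t - L.mat t = τ • V.mat t := fun t => by
      rw [← mat_sub, add_sub_cancel_left]; rfl
    have : gainLoss S C K L (L + τ • V) = -(τ * φ τ) := by
      rw [gainLoss, hφ, mul_neg, neg_neg, Finset.mul_sum]
      refine Finset.sum_congr rfl fun t _ => ?_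
      rw [hmat]
      simp only [Matrix.transpose_smul, Matrix.smul_mul, Matrix.mul_smul, Matrix.trace_smul,
        smul_eq_mul]
      ring
    rw [this] at h
    linarith
  have h2 : HasDerivAt (fun τ : ℝ => S.cost 𝒟 K (L + τ • V)) (φ 0) 0 := by
    rw [hasDerivAt_iff_tendsto_slope_zero]
    refine (hφc.tendsto 0).mono_left nhdsWithin_le_nhds |>.congr' ?_
    filter_upwards [self_mem_nhdsWithin] with τ hτ
    have hτ' : τ ≠ 0 := hτ
    simp only [zero_add, hexp, zero_mul, add_zero, add_sub_cancel_left, smul_eq_mul]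
    field_simp
  rw [h1.unique h2, hφ]
  simp

/-- The objective satisfies a global PL inequality. -/
lemma exists_isPL (hN : 0 < N) (hϑ : ∀ᵐ x ∂𝒟, ‖x‖ ≤ ϑ) (hmean : ∫ x, x ∂𝒟 = 0)
    (hcov : (secondMoment 𝒟).PosDef) (hK : K ∈ S.feasible) :
    ∃ μ : ℝ, 0 < μ ∧ S.IsPL (n := n) 𝒟 K μ := by
  have : Nonempty (Fin N) := ⟨⟨0, hN⟩⟩
  obtain ⟨h, hpos, hh⟩ := exists_curvature_bound S hN hK
  obtain ⟨s, hs, hspos⟩ := exists_smul_one_le hcov.isHermitian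
  replace hspos := hspos hcov
  set C := secondMoment 𝒟
  have hcovS : ∀ (L : Gain n m N) t, (S.stateCov C K L t).PosSemidef :=
    fun L t => posSemidef_stateCov S C K L hcov.posSemidef t
  obtain ⟨σ, hσ, hσt⟩ : ∃ σ : ℝ, 0 < σ ∧ ∀ t : Fin (N + 1),
      (σ • (1 : Matrix (Fin m) (Fin m) ℝ) - S.stateCov C K (S.innerSol K) t).PosSemidef := by
    choose r hr _ using fun t => exists_smul_one_le (hcovS (S.innerSol K) t).isHermitian.neg
    obtain ⟨t₀, ht₀⟩ := Finite.exists_min r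
    refine ⟨|r t₀| + 1, by positivity, fun t => ?_⟩
    have : (|r t₀| + 1) • (1 : Matrix (Fin m) (Fin m) ℝ) - S.stateCov C K (S.innerSol K) t
        = (-S.stateCov C K (S.innerSol K) t - r t • (1 : Matrix (Fin m) (Fin m) ℝ))
          + (|r t₀| + 1 + r t) • (1 : Matrix (Fin m) (Fin m) ℝ) := by
      rw [add_smul _ (r t)]; abel
    rw [this]
    refine (hr t).add (Matrix.PosSemidef.one.smul ?_)
    linarith [ht₀ t, neg_abs_le (r t₀)]
  refine ⟨4 * s ^ 2 * h / σ, by positivity, fun L => ?_⟩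
  set E : Gain n m N := Gain.ofMat (gradFactor S K L) with hE
  have hup : S.cost 𝒟 K (S.innerSol K) - S.cost 𝒟 K L ≤ h⁻¹ * (σ * ‖E‖ ^ 2) := by
    have h1 := cost_sub_cost S K L (S.innerSol K) hϑ hmean hcov.posSemidef
    have h2 : -gainLoss S C K L (S.innerSol K) ≤ h⁻¹ * (σ * ‖E‖ ^ 2) := by
      rw [gainLoss, norm_sq_eq_sum_trace, Finset.mul_sum, Finset.mul_sum, ← Finset.sum_neg_distrib]
      refine Finset.sum_le_sum fun t _ => ?_
      refine (neg_two_trace_sub_trace_le hpos (hh L t) (hcovS _ _) _ _).trans ?_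
      exact mul_le_mul_of_nonneg_left (trace_transpose_mul_mul_le (hσt _) _) (by positivity)
    linarith
  have hlow : 2 * s * ‖E‖ ^ 2 ≤ ‖gradient (S.cost 𝒟 K) L‖ * ‖E‖ := by
    have h1 := inner_gradient_cost S hϑ hmean hcov.posSemidef L E (K := K)
    have h2 := abs_real_inner_le_norm (gradient (S.cost 𝒟 K) L) E
    have h3 : 2 * s * ‖E‖ ^ 2 ≤ -inner ℝ (gradient (S.cost 𝒟 K) L) E := by
      rw [h1, neg_neg, norm_sq_eq_sum_trace, Finset.mul_sum]
      refine Finset.sum_le_sum fun t _ => ?_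
      have hlb := (posSemidef_stateCov_sub S C K L hcov.posSemidef t.castSucc).add hs
      rw [sub_add_sub_cancel] at hlb
      have h4 := le_trace_transpose_mul_mul_mul (M := (1 : Matrix (Fin n) (Fin n) ℝ)) zero_le_one
        (by simpa using Matrix.PosSemidef.zero) hlb (hcovS L _) (E.mat t)
      rw [Matrix.mul_one, one_mul] at h4
      rw [hE, mat_ofMat] at h4 ⊢
      linarith
    linarith [neg_le_of_abs_le h2]
  have hgrad : 2 * s * ‖E‖ ≤ ‖gradient (S.cost 𝒟 K) L‖ := by
    rcases (norm_nonneg E).eq_or_lt with h0 | h0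
    · rw [← h0, mul_zero]; exact norm_nonneg _
    · refine le_of_mul_le_mul_right ?_ h0
      linarith
  calc 4 * s ^ 2 * h / σ * (S.cost 𝒟 K (S.innerSol K) - S.cost 𝒟 K L)
      ≤ 4 * s ^ 2 * h / σ * (h⁻¹ * (σ * ‖E‖ ^ 2)) := by gcongr
    _ = (2 * s * ‖E‖) ^ 2 := by field_simp; ring
    _ ≤ _ := by gcongr

end Deterministic

/-! ### Moments of the uniform distribution on the sphere -/

section Sphere

lemma integral_toSphere_comp_isometry {E : Type*} [NormedAddCommGroup E] [InnerProductSpace ℝ E]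
    [FiniteDimensional ℝ E] [MeasurableSpace E] [BorelSpace E] (e : E ≃ₗᵢ[ℝ] E)
    {f : E → ℝ} :
    ∫ U, f (e (U : E)) ∂((volume : Measure E).toSphere)
      = ∫ U, f (U : E) ∂((volume : Measure E).toSphere) := by
  have hmem : ∀ {x : E}, x ∈ Metric.sphere (0 : E) 1 ↔ e x ∈ Metric.sphere (0 : E) 1 := by
    intro x; simp
  let g : Metric.sphere (0 : E) 1 ≃ₜ Metric.sphere (0 : E) 1 :=
    e.toHomeomorph.subtype fun x => hmem
  have hg : MeasurePreserving g (volume : Measure E).toSphere (volume : Measure E).toSphere := by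
    refine ⟨g.continuous.measurable, ?_⟩
    ext s hs
    rw [Measure.map_apply g.continuous.measurable hs, Measure.toSphere_apply' _ hs,
      Measure.toSphere_apply' _ (g.continuous.measurable hs)]
    congr 1
    have hset : Set.Ioo (0 : ℝ) 1 • ((↑) '' (g ⁻¹' s) : Set E)
        = e ⁻¹' (Set.Ioo (0 : ℝ) 1 • ((↑) '' s)) := by
      ext x
      simp only [Set.mem_smul, Set.mem_image, Set.mem_preimage]
      constructor
      · rintro ⟨c, hc, _, ⟨u, hu, rfl⟩, rfl⟩
        exact ⟨c, hc, e u, ⟨g u, hu, rfl⟩, by simp⟩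
      · rintro ⟨c, hc, _, ⟨u, hu, rfl⟩, hx⟩
        refine ⟨c, hc, e.symm u, ⟨g.symm u, by simpa using hu, rfl⟩, ?_⟩
        rw [← map_smul, hx, e.symm_apply_apply]
    rw [hset]
    exact e.measurePreserving.measure_preimage_emb e.toHomeomorph.measurableEmbedding _
  exact hg.integral_comp g.measurableEmbedding (fun U => f (U : E))

variable {p m N : ℕ}

lemma integral_uniformSphere_isometry (e : Gain p m N ≃ₗᵢ[ℝ] Gain p m N) (f : Gain p m N → ℝ) :
    ∫ U, f (e (U : Gain p m N)) ∂(uniformSphere p m N)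
      = ∫ U, f (U : Gain p m N) ∂(uniformSphere p m N) := by
  simp only [uniformSphere, integral_smul_measure, integral_toSphere_comp_isometry]

lemma isProbabilityMeasure_uniformSphere (hp : 0 < p) (hm : 0 < m) (hN : 0 < N) :
    IsProbabilityMeasure (uniformSphere p m N) := by
  have : Nonempty (Fin N × Fin p × Fin m) := ⟨⟨0, hN⟩, ⟨0, hp⟩, ⟨0, hm⟩⟩
  have : Nontrivial (Gain p m N) := inferInstance
  refine ⟨?_⟩
  rw [uniformSphere, Measure.smul_apply, smul_eq_mul]
  exact ENNReal.inv_mul_cancel (by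
    simpa only [ne_eq, Measure.measure_univ_eq_zero] using
      Measure.toSphere_ne_zero (volume : Measure (Gain p m N))) (measure_ne_top _ _)

lemma norm_sphere (U : Metric.sphere (0 : Gain p m N) 1) : ‖(U : Gain p m N)‖ = 1 :=
  norm_eq_of_mem_sphere U

lemma abs_sphere_apply_le (U : Metric.sphere (0 : Gain p m N) 1) (q : Fin N × Fin p × Fin m) :
    |(U : Gain p m N) q| ≤ 1 := by
  have := PiLp.norm_apply_le (U : Gain p m N) q
  rwa [norm_sphere, Real.norm_eq_abs] at this

lemma integrable_uniformSphere [IsProbabilityMeasure (uniformSphere p m N)]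
    {f : Gain p m N → ℝ} (hf : Continuous f) :
    Integrable (fun U : Metric.sphere (0 : Gain p m N) 1 => f U) (uniformSphere p m N) := by
  have h : Continuous fun U : Metric.sphere (0 : Gain p m N) 1 => f U :=
    hf.comp continuous_subtype_val
  exact (BoundedContinuousFunction.mkOfCompact ⟨_, h⟩).integrable _

lemma integral_sphere_apply (q : Fin N × Fin p × Fin m) :
    ∫ U : Metric.sphere (0 : Gain p m N) 1, (U : Gain p m N) q ∂(uniformSphere p m N) = 0 := by
  have h := integral_uniformSphere_isometry (LinearIsometryEquiv.neg ℝ)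
    (fun U : Gain p m N => U q)
  simp only [LinearIsometryEquiv.coe_neg, PiLp.neg_apply, integral_neg] at h
  linarith

lemma integral_sphere_inner_sq_eq {v w : Gain p m N} (h : ‖v‖ = ‖w‖) :
    ∫ U : Metric.sphere (0 : Gain p m N) 1, inner ℝ (U : Gain p m N) v ^ 2 ∂(uniformSphere p m N)
      = ∫ U : Metric.sphere (0 : Gain p m N) 1, inner ℝ (U : Gain p m N) w ^ 2
        ∂(uniformSphere p m N) := by
  rw [← integral_uniformSphere_isometry (ℝ ∙ (v - w))ᗮ.reflection (fun U => inner ℝ U w ^ 2)]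
  refine integral_congr_ae (.of_forall fun U => ?_)
  have h1 := LinearIsometryEquiv.inner_map_map (ℝ ∙ (v - w))ᗮ.reflection (U : Gain p m N) v
  rw [Submodule.reflection_sub h] at h1
  exact congrArg (· ^ 2) h1.symm

lemma integral_sphere_mul [IsProbabilityMeasure (uniformSphere p m N)]
    (q q' : Fin N × Fin p × Fin m) :
    ∫ U : Metric.sphere (0 : Gain p m N) 1, (U : Gain p m N) q * (U : Gain p m N) q'
      ∂(uniformSphere p m N) = if q = q' then (((p * m * N : ℕ) : ℝ))⁻¹ else 0 := by
  have hI : ∀ f : Gain p m N → ℝ, Continuous f →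
      Integrable (fun U : Metric.sphere (0 : Gain p m N) 1 => f U) (uniformSphere p m N) :=
    fun f hf => integrable_uniformSphere hf
  split_ifs with hq
  · subst hq
    have heq : ∀ q', ∫ U : Metric.sphere (0 : Gain p m N) 1,
        (U : Gain p m N) q' * (U : Gain p m N) q' ∂(uniformSphere p m N)
        = ∫ U : Metric.sphere (0 : Gain p m N) 1, (U : Gain p m N) q * (U : Gain p m N) q
        ∂(uniformSphere p m N) := fun q' => by
      have := integral_sphere_inner_sq_eq (p := p) (m := m) (N := N)
        (v := EuclideanSpace.single q' 1) (w := EuclideanSpace.single q 1) (by simp)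
      simpa [EuclideanSpace.inner_single_right, sq] using this
    have hsum : ∑ q', ∫ U : Metric.sphere (0 : Gain p m N) 1,
        (U : Gain p m N) q' * (U : Gain p m N) q' ∂(uniformSphere p m N) = 1 := by
      rw [← integral_finsetSum _ fun q' _ => hI (fun U => U q' * U q') (by fun_prop)]
      have : ∀ U : Metric.sphere (0 : Gain p m N) 1,
          ∑ q', (U : Gain p m N) q' * (U : Gain p m N) q' = 1 := fun U => by
        have h := EuclideanSpace.real_norm_sq_eq (U : Gain p m N)
        rw [norm_sphere] at h
        simpa [sq] using h.symm
      simp [this]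
    simp only [heq, Finset.sum_const, Finset.card_univ, nsmul_eq_mul, Fintype.card_prod,
      Fintype.card_fin] at hsum
    refine eq_inv_of_mul_eq_one_left (Eq.trans ?_ hsum)
    push_cast
    ring
  · have hnorm : ‖(EuclideanSpace.single q 1 + EuclideanSpace.single q' 1 : Gain p m N)‖
        = ‖(EuclideanSpace.single q 1 - EuclideanSpace.single q' 1 : Gain p m N)‖ := by
      have horth : inner ℝ (EuclideanSpace.single q' 1 : Gain p m N) (EuclideanSpace.single q 1)
          = 0 := by simp [EuclideanSpace.inner_single_left, hq]
      exact (norm_sub_eq_norm_add horth).symm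
    have h := integral_sphere_inner_sq_eq hnorm
    simp only [inner_add_right, inner_sub_right, EuclideanSpace.inner_single_right,
      one_mul, conj_trivial] at h
    have h1 : ∀ U : Gain p m N, (U q + U q') ^ 2 = (U q - U q') ^ 2 + 4 * (U q * U q') :=
      fun U => by ring
    simp only [h1] at h
    rw [integral_add (hI (fun U => (U q - U q') ^ 2) (by fun_prop))
      (hI (fun U => 4 * (U q * U q')) (by fun_prop)), integral_const_mul] at h
    linarith

lemma integral_sphere_inner_mul [IsProbabilityMeasure (uniformSphere p m N)] (g : Gain p m N)
    (q : Fin N × Fin p × Fin m) :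
    ∫ U : Metric.sphere (0 : Gain p m N) 1, inner ℝ g (U : Gain p m N) * (U : Gain p m N) q
      ∂(uniformSphere p m N) = g q / ((p * m * N : ℕ) : ℝ) := by
  have h : ∀ U : Gain p m N, inner ℝ g U * U q = ∑ q', g q' * (U q' * U q) := fun U => by
    rw [PiLp.inner_apply, Finset.sum_mul]
    refine Finset.sum_congr rfl fun q' _ => ?_
    simp only [RCLike.inner_apply, conj_trivial]
    ring
  simp only [h]
  rw [integral_finsetSum _ fun q' _ => integrable_uniformSphere (f := fun U => g q' * (U q' * U q))
    (by fun_prop)]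
  simp [integral_const_mul, integral_sphere_mul, div_eq_mul_inv]

/-- The bias of the one-point gradient estimate of a function with first-order expansion
`a + r ⟨g, U⟩` up to an error `b` on the sphere. -/
lemma abs_integral_sphere_sub_le (hp : 0 < p) (hm : 0 < m) (hN : 0 < N)
    {φ : Gain p m N → ℝ} (hφ : Continuous φ) {a r b : ℝ}
    (hr : 0 < r) (g : Gain p m N) (hb : ∀ U : Metric.sphere (0 : Gain p m N) 1,
      |φ U - a - r * inner ℝ g (U : Gain p m N)| ≤ b) (q : Fin N × Fin p × Fin m) :
    |∫ U : Metric.sphere (0 : Gain p m N) 1, ((p * m * N : ℕ) : ℝ) / r * φ U * (U : Gain p m N) q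
      ∂(uniformSphere p m N) - g q| ≤ ((p * m * N : ℕ) : ℝ) / r * b := by
  have := isProbabilityMeasure_uniformSphere hp hm hN
  have hd : (0 : ℝ) < ((p * m * N : ℕ) : ℝ) := by positivity
  set D : ℝ := ((p * m * N : ℕ) : ℝ) with hD
  have hrem : ∫ U : Metric.sphere (0 : Gain p m N) 1,
      (φ U - a - r * inner ℝ g (U : Gain p m N)) * (U : Gain p m N) q ∂(uniformSphere p m N)
      = ∫ U : Metric.sphere (0 : Gain p m N) 1, φ U * (U : Gain p m N) q ∂(uniformSphere p m N)
        - r * (g q / D) := by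
    have h : ∀ U : Gain p m N, (φ U - a - r * inner ℝ g U) * U q
        = φ U * U q - a * U q - r * (inner ℝ g U * U q) := fun U => by ring
    simp only [h]
    have h1 := integrable_uniformSphere (f := fun U => φ U * U q) (by fun_prop)
    have h2 := integrable_uniformSphere (f := fun U : Gain p m N => a * U q) (by fun_prop)
    have h3 := integrable_uniformSphere (f := fun U : Gain p m N => r * (inner ℝ g U * U q))
      (by fun_prop)
    rw [integral_sub (by exact h1.sub h2) h3, integral_sub h1 h2, integral_const_mul, integral_const_mul,
      integral_sphere_apply, integral_sphere_inner_mul]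
    ring
  have hbound : |∫ U : Metric.sphere (0 : Gain p m N) 1,
      (φ U - a - r * inner ℝ g (U : Gain p m N)) * (U : Gain p m N) q ∂(uniformSphere p m N)|
      ≤ b := by
    have := norm_integral_le_of_norm_le_const (μ := uniformSphere p m N) (C := b)
      (f := fun U => (φ U - a - r * inner ℝ g (U : Gain p m N)) * (U : Gain p m N) q)
      (.of_forall fun U => by
        rw [norm_mul, Real.norm_eq_abs, Real.norm_eq_abs]
        calc _ ≤ b * 1 := mul_le_mul (hb U) (abs_sphere_apply_le U q) (abs_nonneg _)
              ((abs_nonneg _).trans (hb U))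
          _ = b := mul_one b)
    simpa using this
  rw [hrem] at hbound
  simp only [mul_assoc, integral_const_mul]
  have h4 : D / r * ∫ U : Metric.sphere (0 : Gain p m N) 1, φ U * (U : Gain p m N) q
      ∂(uniformSphere p m N) - g q = D / r * (∫ U : Metric.sphere (0 : Gain p m N) 1,
        φ U * (U : Gain p m N) q ∂(uniformSphere p m N) - r * (g q / D)) := by
    field_simp
  rw [h4, abs_mul, abs_of_pos (div_pos hd hr)]
  exact mul_le_mul_of_nonneg_left hbound (by positivity)

end Sphere

/-! ### Concentration of minibatch averages -/

section Hoeffding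

variable {Ω : Type*} [MeasurableSpace Ω] {σ : Measure Ω} [IsProbabilityMeasure σ]

lemma measure_abs_average_sub_ge_le {X : Ω → ℝ} (hX : Measurable X) {B : ℝ} (hB : 0 < B)
    (hXB : ∀ᵐ ω ∂σ, |X ω| ≤ B) {M : ℕ} (hM : 0 < M) {t : ℝ} (ht : 0 ≤ t) :
    (Measure.pi fun _ : Fin M => σ) {b | t ≤ |1 / (M : ℝ) * ∑ i, X (b i) - ∫ ω, X ω ∂σ|}
      ≤ ENNReal.ofReal (2 * Real.exp (-(M * t ^ 2 / (2 * B ^ 2)))) := by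
  have hM' : (0 : ℝ) < M := by positivity
  -- one tail, for `X` and for `-X`
  have key : ∀ Y : Ω → ℝ, Measurable Y → (∀ᵐ ω ∂σ, |Y ω| ≤ B) →
      (Measure.pi fun _ : Fin M => σ).real {b | M * t ≤ ∑ i, (Y (b i) - ∫ ω, Y ω ∂σ)}
        ≤ Real.exp (-(M * t ^ 2 / (2 * B ^ 2))) := by
    intro Y hY hYB
    have hsub := ProbabilityTheory.hasSubgaussianMGF_of_mem_Icc (μ := σ) (a := -B) (b := B)
      hY.aemeasurable (hYB.mono fun ω h => abs_le.mp h)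
    have hind : ProbabilityTheory.iIndepFun
        (fun (i : Fin M) (b : Fin M → Ω) => Y (b i) - ∫ ω, Y ω ∂σ) (Measure.pi fun _ => σ) :=
      ProbabilityTheory.iIndepFun_pi (μ := fun _ : Fin M => σ)
        (Ω := fun _ : Fin M => Ω)
        (X := fun _ (ω : Ω) => Y ω - ∫ ω, Y ω ∂σ) (fun _ => (hY.sub_const _).aemeasurable)
    have hsubi : ∀ i ∈ (Finset.univ : Finset (Fin M)), ProbabilityTheory.HasSubgaussianMGF
        (fun b : Fin M → Ω => Y (b i) - ∫ ω, Y ω ∂σ) ((‖B - -B‖₊ / 2) ^ 2)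
        (Measure.pi fun _ => σ) := fun i _ => by
      refine ProbabilityTheory.HasSubgaussianMGF.of_map (Y := fun b : Fin M → Ω => b i)
        (X := fun ω : Ω => Y ω - ∫ ω, Y ω ∂σ) (measurable_pi_apply i).aemeasurable ?_
      rw [(measurePreserving_eval (fun _ : Fin M => σ) i).map_eq]
      exact hsub
    have h := ProbabilityTheory.HasSubgaussianMGF.measure_sum_ge_le_of_iIndepFun hind hsubi
      (ε := M * t) (by positivity)
    refine h.trans_eq ?_
    congr 1
    have hBB : ((‖B - -B‖₊ : ℝ) / 2) = B := by
      rw [coe_nnnorm, Real.norm_eq_abs, abs_of_pos (by linarith)]; ring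
    simp only [Finset.sum_const, Finset.card_univ, Fintype.card_fin, nsmul_eq_mul,
      NNReal.coe_mul, NNReal.coe_natCast, NNReal.coe_pow, NNReal.coe_div, NNReal.coe_ofNat, hBB]
    field_simp
  have hset : {b : Fin M → Ω | t ≤ |1 / (M : ℝ) * ∑ i, X (b i) - ∫ ω, X ω ∂σ|}
      ⊆ {b | M * t ≤ ∑ i, (X (b i) - ∫ ω, X ω ∂σ)}
        ∪ {b | M * t ≤ ∑ i, (-X (b i) - ∫ ω, -X ω ∂σ)} := by
    intro b hb
    simp only [Set.mem_ofPred_eq, Set.mem_union] at hb ⊢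
    have h1 : ∑ i, (X (b i) - ∫ ω, X ω ∂σ)
        = M * (1 / (M : ℝ) * ∑ i, X (b i) - ∫ ω, X ω ∂σ) := by
      rw [Finset.sum_sub_distrib]
      simp only [Finset.sum_const, Finset.card_univ, Fintype.card_fin, nsmul_eq_mul]
      field_simp
    have h2 : ∑ i, (-X (b i) - ∫ ω, -X ω ∂σ) = -∑ i, (X (b i) - ∫ ω, X ω ∂σ) := by
      rw [integral_neg, ← Finset.sum_neg_distrib]
      exact Finset.sum_congr rfl fun i _ => by ring
    rw [h2, h1, ← mul_neg]
    rcases le_abs.mp hb with h | h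
    · exact .inl (mul_le_mul_of_nonneg_left h hM'.le)
    · exact .inr (mul_le_mul_of_nonneg_left h hM'.le)
  refine (measure_mono hset).trans ((measure_union_le _ _).trans ?_)
  rw [two_mul, ENNReal.ofReal_add (Real.exp_pos _).le (Real.exp_pos _).le]
  have hconv : ∀ s : Set (Fin M → Ω), ∀ x : ℝ, (Measure.pi fun _ : Fin M => σ).real s ≤ x →
      (Measure.pi fun _ : Fin M => σ) s ≤ ENNReal.ofReal x := fun s x h => by
    rw [← ofReal_measureReal]; exact ENNReal.ofReal_le_ofReal h
  exact add_le_add (hconv _ _ (key X hX hXB))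
    (hconv _ _ (key (fun ω => -X ω) hX.neg (by simpa using hXB)))

/-- A minibatch average of bounded vectors whose mean is coordinatewise `s`-close to `g` is, with
high probability, `e`-close to `g`. -/
lemma measure_norm_average_sub_gt_le {ι : Type*} [Fintype ι] {F : Ω → EuclideanSpace ℝ ι}
    (hF : Measurable F) {B : ℝ} (hB : 0 < B) (hFB : ∀ᵐ ω ∂σ, ∀ q, |F ω q| ≤ B)
    {M : ℕ} (hM : 0 < M) (g : EuclideanSpace ℝ ι) {s t e : ℝ} (ht : 0 ≤ t)
    (hbias : ∀ q, |∫ ω, F ω q ∂σ - g q| ≤ s) (he : 0 ≤ e)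
    (hst : Fintype.card ι * (s + t) ^ 2 ≤ e ^ 2) :
    (Measure.pi fun _ : Fin M => σ) {b | e < ‖(1 / (M : ℝ)) • ∑ i, F (b i) - g‖}
      ≤ ENNReal.ofReal (2 * Fintype.card ι * Real.exp (-(M * t ^ 2 / (2 * B ^ 2)))) := by
  have hset : {b : Fin M → Ω | e < ‖(1 / (M : ℝ)) • ∑ i, F (b i) - g‖}
      ⊆ ⋃ q, {b | t ≤ |1 / (M : ℝ) * ∑ i, F (b i) q - ∫ ω, F ω q ∂σ|} := by
    intro b hb
    simp only [Set.mem_ofPred_eq, Set.mem_iUnion] at hb ⊢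
    by_contra! hcon
    refine absurd hb (not_lt.mpr ?_)
    refine le_of_sq_le_sq ?_ he
    rw [EuclideanSpace.real_norm_sq_eq]
    refine le_trans ?_ hst
    rw [← nsmul_eq_mul, ← Finset.card_univ]
    refine Finset.sum_le_card_nsmul _ _ _ fun q _ => ?_
    have h1 : ((1 / (M : ℝ)) • ∑ i, F (b i) - g) q
        = (1 / (M : ℝ) * ∑ i, F (b i) q - ∫ ω, F ω q ∂σ) + (∫ ω, F ω q ∂σ - g q) := by
      simp
    rw [h1]
    refine sq_le_sq' ?_ ?_
    · have := neg_abs_le (1 / (M : ℝ) * ∑ i, F (b i) q - ∫ ω, F ω q ∂σ)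
      linarith [hcon q, hbias q, neg_abs_le (∫ ω, F ω q ∂σ - g q)]
    · have := le_abs_self (1 / (M : ℝ) * ∑ i, F (b i) q - ∫ ω, F ω q ∂σ)
      linarith [hcon q, hbias q, le_abs_self (∫ ω, F ω q ∂σ - g q)]
  refine (measure_mono hset).trans ((measure_iUnion_fintype_le _ _).trans ?_)
  calc _ ≤ ∑ _q : ι, ENNReal.ofReal (2 * Real.exp (-(M * t ^ 2 / (2 * B ^ 2)))) :=
        Finset.sum_le_sum fun q _ => measure_abs_average_sub_ge_le (X := fun ω => F ω q)
          (by fun_prop) hB (hFB.mono fun ω h => h q) hM ht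
    _ = _ := by
        rw [Finset.sum_const, Finset.card_univ, nsmul_eq_mul, ← ENNReal.ofReal_natCast,
          ← ENNReal.ofReal_mul (by positivity)]
        congr 1
        ring

end Hoeffding

/-! ### Smooth functions on balls -/

section Regular

variable {E : Type*} [NormedAddCommGroup E] [InnerProductSpace ℝ E] [CompleteSpace E]

/-- On the closed ball of radius `R` around `0`, the gradient of `f` is bounded by `c`, the
functions `f` and `∇ f` are `c`-Lipschitz, and the first-order Taylor remainder of `f` is at most
`c` times the squared increment. -/
structure RegularOnBall (f : E → ℝ) (c R : ℝ) : Prop where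
  norm_gradient_le : ∀ x, ‖x‖ ≤ R → ‖gradient f x‖ ≤ c
  norm_gradient_sub_le : ∀ x y, ‖x‖ ≤ R → ‖y‖ ≤ R → ‖gradient f y - gradient f x‖ ≤ c * ‖y - x‖
  abs_sub_le : ∀ x y, ‖x‖ ≤ R → ‖y‖ ≤ R → |f y - f x| ≤ c * ‖y - x‖
  abs_taylor_le : ∀ x y, ‖x‖ ≤ R → ‖y‖ ≤ R →
    |f y - f x - inner ℝ (gradient f x) (y - x)| ≤ c * ‖y - x‖ ^ 2

lemma RegularOnBall.mono {f : E → ℝ} {c c' R R' : ℝ} (h : RegularOnBall f c R) (hc : c ≤ c')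
    (hR : R' ≤ R) : RegularOnBall f c' R' where
  norm_gradient_le x hx := (h.norm_gradient_le x (hx.trans hR)).trans hc
  norm_gradient_sub_le x y hx hy :=
    (h.norm_gradient_sub_le x y (hx.trans hR) (hy.trans hR)).trans (by gcongr)
  abs_sub_le x y hx hy := (h.abs_sub_le x y (hx.trans hR) (hy.trans hR)).trans (by gcongr)
  abs_taylor_le x y hx hy := (h.abs_taylor_le x y (hx.trans hR) (hy.trans hR)).trans (by gcongr)

lemma continuous_gradient {f : E → ℝ} (hf : ContDiff ℝ 2 f) : Continuous (gradient f) :=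
  (InnerProductSpace.toDual ℝ E).symm.continuous.comp (hf.continuous_fderiv (by norm_num))

lemma norm_gradient_sub_gradient (f : E → ℝ) (x y : E) :
    ‖gradient f y - gradient f x‖ = ‖fderiv ℝ f y - fderiv ℝ f x‖ := by
  simp only [gradient, ← map_sub, LinearIsometryEquiv.norm_map]

lemma exists_regularOnBall [FiniteDimensional ℝ E] {f : E → ℝ} (hf : ContDiff ℝ 2 f) (R : ℝ) :
    ∃ c, RegularOnBall f c R := by
  have := FiniteDimensional.proper ℝ E
  have hcomp : IsCompact (Metric.closedBall (0 : E) R) := isCompact_closedBall 0 R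
  have hconv : Convex ℝ (Metric.closedBall (0 : E) R) := convex_closedBall 0 R
  have hmem : ∀ {x : E}, x ∈ Metric.closedBall (0 : E) R ↔ ‖x‖ ≤ R := by simp
  have hf1 : ContDiff ℝ 1 (fderiv ℝ f) := hf.fderiv_right (by norm_num)
  have hd : Differentiable ℝ f := hf.differentiable (by norm_num)
  obtain ⟨c₁, h₁⟩ := hcomp.exists_bound_of_continuousOn (continuous_gradient hf).continuousOn
  obtain ⟨c₂, h₂⟩ := hcomp.exists_bound_of_continuousOn
    (hf1.continuous_fderiv (by norm_num)).continuousOn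
  have hlip : ∀ x y : E, ‖x‖ ≤ R → ‖y‖ ≤ R →
      ‖fderiv ℝ f y - fderiv ℝ f x‖ ≤ max c₁ c₂ * ‖y - x‖ := fun x y hx hy =>
    hconv.norm_image_sub_le_of_norm_fderiv_le
      (fun z _ => hf1.differentiable (by norm_num) z)
      (fun z hz => (h₂ z hz).trans (le_max_right _ _)) (hmem.mpr hx) (hmem.mpr hy)
  refine ⟨max c₁ c₂, fun x hx => (h₁ x (hmem.mpr hx)).trans (le_max_left _ _), ?_, ?_, ?_⟩
  · intro x y hx hy
    rw [norm_gradient_sub_gradient]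
    exact hlip x y hx hy
  · intro x y hx hy
    refine hconv.norm_image_sub_le_of_norm_fderiv_le (f := f) (fun z _ => hd z) (fun z hz => ?_)
      (hmem.mpr hx) (hmem.mpr hy)
    have := (h₁ z hz).trans (le_max_left _ c₂)
    rwa [gradient, LinearIsometryEquiv.norm_map] at this
  · intro x y hx hy
    have hseg : segment ℝ x y ⊆ Metric.closedBall (0 : E) R :=
      hconv.segment_subset (hmem.mpr hx) (hmem.mpr hy)
    have hc : 0 ≤ max c₁ c₂ := (norm_nonneg _).trans ((h₁ x (hmem.mpr hx)).trans (le_max_left _ _))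
    have h := (convex_segment x y).norm_image_sub_le_of_norm_fderiv_le' (f := f)
      (φ := fderiv ℝ f x) (C := max c₁ c₂ * ‖y - x‖) (fun z _ => hd z) (fun z hz => ?_)
      (left_mem_segment ℝ x y) (right_mem_segment ℝ x y)
    · have hin : inner ℝ (gradient f x) (y - x) = fderiv ℝ f x (y - x) := by
        rw [gradient, InnerProductSpace.toDual_symm_apply]
      rw [hin, ← Real.norm_eq_abs, sq, ← mul_assoc]
      exact h
    · refine (hlip x z hx (hmem.mp (hseg hz))).trans (mul_le_mul_of_nonneg_left ?_ hc)
      obtain ⟨a, ha, rfl⟩ := (segment_eq_image' ℝ x y).subset hz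
      rw [add_sub_cancel_left, norm_smul, Real.norm_eq_abs, abs_of_nonneg ha.1]
      exact mul_le_of_le_one_left (norm_nonneg _) ha.2

/-- The constants on balls can be chosen positive and increasing in the radius. -/
lemma exists_monotone_regularOnBall [FiniteDimensional ℝ E] {f : E → ℝ} (hf : ContDiff ℝ 2 f) :
    ∃ c : ℝ → ℝ, Monotone c ∧ (∀ R, 0 < c R) ∧ ∀ R, RegularOnBall f (c R) R := by
  choose c hc using fun k : ℕ => exists_regularOnBall hf k
  refine ⟨fun R => 1 + ∑ k ∈ Finset.range (⌈R⌉₊ + 1), |c k|, fun R R' hR => ?_, fun R => ?_,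
    fun R => ?_⟩
  · have : Finset.range (⌈R⌉₊ + 1) ⊆ Finset.range (⌈R'⌉₊ + 1) :=
      Finset.range_mono (Nat.add_le_add_right (Nat.ceil_mono hR) 1)
    exact (add_le_add_iff_left 1).mpr
      (Finset.sum_le_sum_of_subset_of_nonneg this fun _ _ _ => abs_nonneg _)
  · have : 0 ≤ ∑ k ∈ Finset.range (⌈R⌉₊ + 1), |c k| := Finset.sum_nonneg fun _ _ => abs_nonneg _
    positivity
  · refine (hc ⌈R⌉₊).mono ?_ (Nat.le_ceil R)
    have := Finset.single_le_sum (f := fun k => |c k|) (fun k _ => abs_nonneg _)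
      (Finset.self_mem_range_succ ⌈R⌉₊)
    linarith [le_abs_self (c ⌈R⌉₊)]

/-- One step of inexact gradient ascent under the PL inequality. -/
lemma gap_ascent_step_le {f : E → ℝ} {c R μ fs η e : ℝ} (hreg : RegularOnBall f c (R + 1))
    (hPL : ∀ x, μ * (fs - f x) ≤ ‖gradient f x‖ ^ 2) {x g : E} (hx : ‖x‖ ≤ R)
    (hη : 0 < η) (hη1 : η * (c + 1) ≤ 1) (hη2 : η * (8 * c) ≤ 1)
    (hg : ‖g - gradient f x‖ ≤ e) (he : e ≤ 1) :
    fs - f (x + η • g) ≤ (1 - η * μ / 4) * (fs - f x) + η * e ^ 2 := by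
  set G := gradient f x
  have hxR : ‖x‖ ≤ R + 1 := by linarith
  have hGc : ‖G‖ ≤ c := hreg.norm_gradient_le x hxR
  have hgn : ‖g‖ ≤ c + 1 := by
    have := norm_add_le G (g - G)
    rw [add_sub_cancel] at this
    linarith
  have hstep : ‖x + η • g‖ ≤ R + 1 := by
    refine (norm_add_le _ _).trans (add_le_add hx ?_)
    rw [norm_smul, Real.norm_eq_abs, abs_of_pos hη]
    exact (mul_le_mul_of_nonneg_left hgn hη.le).trans hη1
  have ht := hreg.abs_taylor_le x (x + η • g) hxR hstep
  rw [add_sub_cancel_left, inner_smul_right, norm_smul, Real.norm_eq_abs, abs_of_pos hη] at ht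
  have ht' := neg_le_of_abs_le ht
  -- the error vector
  obtain ⟨v, rfl⟩ : ∃ v, g = G + v := ⟨g - G, by abel⟩
  rw [add_sub_cancel_left] at hg
  have hv : ‖v‖ ^ 2 ≤ e ^ 2 := by gcongr
  have hin : inner ℝ G (G + v) = ‖G‖ ^ 2 + inner ℝ G v := by
    rw [inner_add_right, real_inner_self_eq_norm_sq]
  have h1 : -(‖G‖ ^ 2 / 2 + ‖v‖ ^ 2 / 2) ≤ inner ℝ G v := by
    have := neg_le_of_abs_le (abs_real_inner_le_norm G v)
    nlinarith [sq_nonneg (‖G‖ - ‖v‖)]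
  have h2 : ‖G + v‖ ^ 2 ≤ 2 * ‖G‖ ^ 2 + 2 * ‖v‖ ^ 2 := by
    have := norm_add_le G v
    nlinarith [sq_nonneg (‖G‖ - ‖v‖), norm_nonneg (G + v), norm_nonneg G, norm_nonneg v]
  have h3 : c * (η * ‖G + v‖) ^ 2 ≤ η * ((2 * ‖G‖ ^ 2 + 2 * ‖v‖ ^ 2) / 8) := by
    have h4 : c * η ≤ 1 / 8 := by linarith
    calc c * (η * ‖G + v‖) ^ 2 = η * (c * η * ‖G + v‖ ^ 2) := by ring
      _ ≤ η * (1 / 8 * (2 * ‖G‖ ^ 2 + 2 * ‖v‖ ^ 2)) := by gcongr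
      _ = _ := by ring
  rw [hin] at ht'
  have h5 := mul_le_mul_of_nonneg_left h1 hη.le
  have h6 := mul_le_mul_of_nonneg_left (hPL x) hη.le
  have h7 := mul_le_mul_of_nonneg_left hv hη.le
  have h8 : 0 ≤ η * ‖v‖ ^ 2 := by positivity
  nlinarith

end Regular

/-! ### The zeroth-order oracle -/

section Oracle

variable {m n d N : ℕ} (S : LQGame m n d N) (K : Gain d m N)

lemma continuous_mat (t : Fin N) : Continuous fun L : Gain n m N => L.mat t :=
  continuous_matrix fun i j => by
    simp only [Gain.mat, Matrix.of_apply]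
    fun_prop

lemma continuous_state (t : Fin (N + 1)) :
    Continuous fun z : Gain n m N × Noise m N => S.state K z.1 z.2 t := by
  induction t using Fin.induction with
  | zero =>
    simp only [S.state_zero]
    fun_prop
  | succ t ih =>
    simp only [S.state_succ]
    have hcl : Continuous fun z : Gain n m N × Noise m N => S.closedLoop K z.1 t :=
      continuous_const.sub (continuous_const.matrix_mul ((continuous_mat t).comp continuous_fst))
    exact (hcl.matrix_mulVec ih).add (by fun_prop)

lemma continuous_rolloutCost :
    Continuous fun z : Gain n m N × Noise m N => S.rolloutCost K z.1 z.2 := by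
  have hx := fun t => continuous_state (n := n) S K t
  have hq : ∀ {q : ℕ} (R : Matrix (Fin q) (Fin q) ℝ) {x : Gain n m N × Noise m N → Fin q → ℝ},
      Continuous x → Continuous fun z => x z ⬝ᵥ (R *ᵥ x z) := fun R x h =>
    h.dotProduct (continuous_const.matrix_mulVec h)
  simp only [LQGame.rolloutCost]
  refine (continuous_finsetSum _ fun t _ => ?_).add (hq _ (hx _))
  exact ((hq _ (hx _)).add (hq _ (continuous_const.matrix_mulVec (hx _)).neg)).sub
    (hq _ (((continuous_mat t).comp continuous_fst).matrix_mulVec (hx _)).neg)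

lemma exists_rolloutCost_bound (R ϑ : ℝ) : ∃ B : ℝ, 0 < B ∧ ∀ (L : Gain n m N) (ζ : Noise m N),
    ‖L‖ ≤ R → (∀ s, ‖ζ s‖ ≤ ϑ) → |S.rolloutCost K L ζ| ≤ B := by
  have hcomp : IsCompact (Metric.closedBall (0 : Gain n m N) R
      ×ˢ Set.univ.pi fun _ : Fin (N + 1) => Metric.closedBall (0 : EuclideanSpace ℝ (Fin m)) ϑ) :=
    (isCompact_closedBall 0 R).prod (isCompact_univ_pi fun _ => isCompact_closedBall 0 ϑ)
  obtain ⟨B, hB⟩ := hcomp.exists_bound_of_continuousOn (continuous_rolloutCost S K).continuousOn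
  refine ⟨|B| + 1, by positivity, fun L ζ hL hζ => ?_⟩
  have := hB (L, ζ) ⟨by simpa using hL, fun s _ => by simpa using hζ s⟩
  rw [Real.norm_eq_abs] at this
  exact this.trans ((le_abs_self B).trans (by linarith))

/-- The gradient estimate from a single sample. -/
noncomputable def oracle (r : ℝ) (L : Gain n m N) (s : Sample n m N) : Gain n m N :=
  (((n * m * N : ℕ) : ℝ) / r * S.rolloutCost K (L + r • (s.1 : Gain n m N)) s.2) •
    (s.1 : Gain n m N)

lemma continuous_oracle (r : ℝ) :
    Continuous fun z : Gain n m N × Sample n m N => oracle S K r z.1 z.2 := by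
  have h : Continuous fun z : Gain n m N × Sample n m N =>
      S.rolloutCost K (z.1 + r • (z.2.1 : Gain n m N)) z.2.2 :=
    (continuous_rolloutCost S K).comp (f := fun z : Gain n m N × Sample n m N =>
      ((z.1 + r • (z.2.1 : Gain n m N), z.2.2) : Gain n m N × Noise m N)) (by fun_prop)
  exact (continuous_const.mul h).smul (by fun_prop)

lemma measurable_oracle (r : ℝ) :
    Measurable fun z : Gain n m N × Sample n m N => oracle S K r z.1 z.2 :=
  (continuous_oracle S K r).measurable

lemma gradEst_eq {M : ℕ} (r : ℝ) (L : Gain n m N) (b : Fin M → Sample n m N) :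
    S.gradEst K r L b = (1 / (M : ℝ)) • ∑ i, oracle S K r L (b i) := rfl

lemma measurable_gradEst {M : ℕ} (r : ℝ) :
    Measurable fun z : Gain n m N × (Fin M → Sample n m N) => S.gradEst K r z.1 z.2 := by
  have h : ∀ i, Measurable fun z : Gain n m N × (Fin M → Sample n m N) =>
      oracle S K r z.1 (z.2 i) := fun i => by
    have ho := measurable_oracle S K (n := n) r
    fun_prop
  simp only [gradEst_eq]
  fun_prop

lemma measurable_zopg (L₀ : Gain n m N) {M : ℕ} (r η : ℝ) (T : ℕ) :
    Measurable fun ω : Fin T → Fin M → Sample n m N => S.zopg K L₀ r η T ω := by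
  induction T with
  | zero => exact measurable_const
  | succ T ih =>
    simp only [LQGame.zopg]
    have hge := measurable_gradEst S K (n := n) (M := M) r
    have h : Measurable fun ω : Fin (T + 1) → Fin M → Sample n m N =>
        S.zopg K L₀ r η T fun l => ω l.castSucc :=
      ih.comp (measurable_pi_iff.mpr fun l => measurable_pi_apply _)
    fun_prop

variable {𝒟 : Measure (EuclideanSpace ℝ (Fin m))} [IsProbabilityMeasure 𝒟] {ϑ : ℝ}

/-- A minibatch gradient estimate has error at most `e` with high probability. -/
lemma measure_gradEst_error_le (hm : 0 < m) (hn : 0 < n) (hN : 0 < N) (hϑ : ∀ᵐ x ∂𝒟, ‖x‖ ≤ ϑ)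
    {c B R : ℝ} (hB : 0 < B) (hreg : RegularOnBall (S.cost 𝒟 K : Gain n m N → ℝ) c (R + 1))
    (hcont : Continuous (S.cost 𝒟 K : Gain n m N → ℝ))
    (hroll : ∀ (L : Gain n m N) (ζ : Noise m N),
      ‖L‖ ≤ R + 1 → (∀ s, ‖ζ s‖ ≤ ϑ) → |S.rolloutCost K L ζ| ≤ B)
    {M : ℕ} (hM : 0 < M) {r t e : ℝ} (hr : 0 < r) (hr1 : r ≤ 1) (ht : 0 ≤ t) (he : 0 ≤ e)
    (hte : ((n * m * N : ℕ) : ℝ) * (((n * m * N : ℕ) : ℝ) * (c * r) + t) ^ 2 ≤ e ^ 2)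
    {L : Gain n m N} (hL : ‖L‖ ≤ R) :
    (Measure.pi fun _ : Fin M => (uniformSphere n m N).prod (noiseLaw N 𝒟))
      {b | e < ‖S.gradEst K r L b - gradient (S.cost 𝒟 K) L‖}
      ≤ ENNReal.ofReal (2 * ((n * m * N : ℕ) : ℝ)
        * Real.exp (-(M * t ^ 2 / (2 * (((n * m * N : ℕ) : ℝ) / r * B) ^ 2)))) := by
  have := isProbabilityMeasure_uniformSphere hn hm hN
  have hd : (0 : ℝ) < ((n * m * N : ℕ) : ℝ) := by positivity
  have hcard : (Fintype.card (Fin N × Fin n × Fin m) : ℝ) = ((n * m * N : ℕ) : ℝ) := by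
    simp; ring
  set D : ℝ := ((n * m * N : ℕ) : ℝ) with hD
  set σ := (uniformSphere n m N).prod (noiseLaw N 𝒟) with hσ
  have hball : ∀ U : Metric.sphere (0 : Gain n m N) 1, ‖L + r • (U : Gain n m N)‖ ≤ R + 1 := by
    intro U
    refine (norm_add_le _ _).trans (add_le_add hL ?_)
    rw [norm_smul, norm_sphere, Real.norm_eq_abs, abs_of_pos hr, mul_one]
    exact hr1
  have hF : Measurable (oracle S K r L) :=
    ((continuous_oracle S K r).comp (Continuous.prodMk_right L)).measurable
  have hζ : ∀ᵐ s ∂σ, ∀ i, ‖s.2 i‖ ≤ ϑ :=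
    Measure.quasiMeasurePreserving_snd.ae (ae_norm_noise_le hϑ)
  have hFB : ∀ᵐ s ∂σ, ∀ q, |oracle S K r L s q| ≤ D / r * B := by
    filter_upwards [hζ] with s hs q
    simp only [oracle, PiLp.smul_apply, smul_eq_mul, ← hD]
    rw [abs_mul, abs_mul, abs_of_pos (div_pos hd hr)]
    calc _ ≤ D / r * B * 1 := by
          gcongr
          · exact hroll _ _ (hball _) hs
          · exact abs_sphere_apply_le _ _
      _ = D / r * B := mul_one _
  have hcalc : ∀ q, |∫ s, oracle S K r L s q ∂σ - gradient (S.cost 𝒟 K) L q| ≤ D * (c * r) := by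
    intro q
    have hint : Integrable (fun s => oracle S K r L s q) σ :=
      Integrable.of_bound
        ((EuclideanSpace.proj (𝕜 := ℝ) q).continuous.measurable.comp hF).aestronglyMeasurable
        (D / r * B)
        (hFB.mono fun s hs => hs q)
    have hval : ∫ s, oracle S K r L s q ∂σ = ∫ U : Metric.sphere (0 : Gain n m N) 1,
        D / r * S.cost 𝒟 K (L + r • (U : Gain n m N)) * (U : Gain n m N) q
          ∂(uniformSphere n m N) := by
      rw [hσ, integral_prod _ hint]
      refine integral_congr_ae (.of_forall fun U => ?_)
      simp only [oracle, PiLp.smul_apply, smul_eq_mul, LQGame.cost]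
      rw [integral_mul_const, integral_const_mul]
    rw [hval]
    refine (abs_integral_sphere_sub_le hn hm hN
      (φ := fun U => S.cost 𝒟 K (L + r • U)) (a := S.cost 𝒟 K L) (b := c * r ^ 2)
      (hcont.comp (by fun_prop)) hr _ (fun U => ?_) q).trans_eq ?_
    · have h := hreg.abs_taylor_le L (L + r • (U : Gain n m N)) (by linarith) (hball U)
      rw [add_sub_cancel_left, inner_smul_right, norm_smul, norm_sphere, Real.norm_eq_abs,
        abs_of_pos hr, mul_one] at h
      exact h
    · rw [← hD]
      field_simp
  have hmain := measure_norm_average_sub_gt_le hF (B := D / r * B) (by positivity) hFB hM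
    (gradient (S.cost 𝒟 K) L) ht hcalc he (by rw [hcard]; exact hte)
  rw [hcard] at hmain
  exact hmain

/-! ### The iteration -/

/-- If from every point with optimality gap at most `Δmax` a single minibatch has error at most `e`
with probability at least `1 - p`, and ascent steps with such an error contract the gap towards
`ν`, then with probability at least `1 - T p` the gap after `T` steps is at most `q ^ T Δ₀ + ν`. -/
lemma runLaw_gap_le (hm : 0 < m) (hn : 0 < n) (hN : 0 < N)
    (hsm : ContDiff ℝ 2 (S.cost 𝒟 K : Gain n m N → ℝ)) {M : ℕ} {r η e q ν Gs Δmax : ℝ}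
    {p : ENNReal} (L₀ : Gain n m N) (hq0 : 0 ≤ q) (hq1 : q ≤ 1) (hΔ₀ : 0 ≤ Gs - S.cost 𝒟 K L₀)
    (hν : 0 ≤ ν) (hmax : Gs - S.cost 𝒟 K L₀ + ν ≤ Δmax)
    (hp : ∀ L : Gain n m N, Gs - S.cost 𝒟 K L ≤ Δmax →
      (Measure.pi fun _ : Fin M => (uniformSphere n m N).prod (noiseLaw N 𝒟))
        {b | e < ‖S.gradEst K r L b - gradient (S.cost 𝒟 K) L‖} ≤ p)
    (hstep : ∀ L g : Gain n m N, Gs - S.cost 𝒟 K L ≤ Δmax →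
      ‖g - gradient (S.cost 𝒟 K) L‖ ≤ e →
      Gs - S.cost 𝒟 K (L + η • g) ≤ q * (Gs - S.cost 𝒟 K L) + (1 - q) * ν) (T : ℕ) :
    (runLaw n N 𝒟 T M) {ω | q ^ T * (Gs - S.cost 𝒟 K L₀) + ν
      < Gs - S.cost 𝒟 K (S.zopg K L₀ r η T ω)} ≤ T * p := by
  have := isProbabilityMeasure_uniformSphere hn hm hN
  set σ : Measure (Fin M → Sample n m N) :=
    Measure.pi fun _ => (uniformSphere n m N).prod (noiseLaw N 𝒟) with hσ
  have hrun : ∀ T, runLaw n N 𝒟 T M = Measure.pi fun _ : Fin T => σ := fun T => rfl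
  induction T with
  | zero =>
    have : {ω : Fin 0 → Fin M → Sample n m N | q ^ 0 * (Gs - S.cost 𝒟 K L₀) + ν
        < Gs - S.cost 𝒟 K (S.zopg K L₀ r η 0 ω)} = ∅ := by
      ext ω
      simp only [LQGame.zopg, pow_zero, one_mul, Set.mem_ofPred_eq, Set.mem_empty_iff_false,
        iff_false, not_lt]
      linarith
    rw [this, measure_empty]
    exact zero_le
  | succ T ih =>
    set bad : Set (Fin T → Fin M → Sample n m N) := {ω | q ^ T * (Gs - S.cost 𝒟 K L₀) + ν
      < Gs - S.cost 𝒟 K (S.zopg K L₀ r η T ω)} with hbad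
    have hZ := measurable_zopg S K L₀ (M := M) r η T
    have hbadm : MeasurableSet bad := by
      refine measurableSet_lt measurable_const ?_
      exact measurable_const.sub (hsm.continuous.measurable.comp hZ)
    set err : Set ((Fin M → Sample n m N) × (Fin T → Fin M → Sample n m N)) :=
      {z | e < ‖S.gradEst K r (S.zopg K L₀ r η T z.2) z.1
        - gradient (S.cost 𝒟 K) (S.zopg K L₀ r η T z.2)‖} with herr
    have herrm : MeasurableSet err := by
      refine measurableSet_lt measurable_const (Measurable.norm (Measurable.sub ?_ ?_))
      · have hge := measurable_gradEst S K (n := n) (M := M) r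
        fun_prop
      · have hG := (continuous_gradient hsm).measurable
        fun_prop
    have hmp := measurePreserving_piFinSuccAbove (fun _ : Fin (T + 1) => σ) (Fin.last T)
    have hsub : {ω : Fin (T + 1) → Fin M → Sample n m N |
        q ^ (T + 1) * (Gs - S.cost 𝒟 K L₀) + ν
          < Gs - S.cost 𝒟 K (S.zopg K L₀ r η (T + 1) ω)}
        ⊆ (MeasurableEquiv.piFinSuccAbove (fun _ => Fin M → Sample n m N) (Fin.last T)) ⁻¹'
          (Set.univ ×ˢ bad ∪ err ∩ Set.univ ×ˢ badᶜ) := by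
      intro ω hω
      have hsplit : MeasurableEquiv.piFinSuccAbove (fun _ => Fin M → Sample n m N) (Fin.last T) ω
          = (ω (Fin.last T), fun l => ω l.castSucc) := by
        refine Prod.ext rfl (funext fun l => ?_)
        exact congrArg ω (Fin.succAbove_last_apply l)
      rw [Set.mem_preimage, hsplit]
      by_contra hcon
      simp only [Set.mem_union, Set.mem_prod, Set.mem_univ, true_and, Set.mem_inter_iff,
        Set.mem_compl_iff, not_or, not_and, not_not] at hcon
      obtain ⟨h1, h2⟩ := hcon
      have h3 : (ω (Fin.last T), fun l : Fin T => ω l.castSucc) ∉ err := fun h => h1 (h2 h)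
      simp only [hbad, Set.mem_ofPred_eq, not_lt] at h1
      simp only [herr, Set.mem_ofPred_eq, not_lt] at h3
      have hqT : q ^ T ≤ 1 := pow_le_one₀ hq0 hq1
      have h4 := hstep _ _ (h1.trans (le_trans (by nlinarith) hmax)) h3
      refine not_lt.mpr (h4.trans ?_) hω
      calc _ ≤ q * (q ^ T * (Gs - S.cost 𝒟 K L₀) + ν) + (1 - q) * ν := by gcongr
        _ = _ := by ring
    refine (measure_mono hsub).trans ?_
    rw [hrun, hmp.measure_preimage_equiv]
    refine (measure_union_le _ _).trans ?_
    rw [Nat.cast_succ, add_mul, one_mul]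
    refine add_le_add ?_ ?_
    · rw [Measure.prod_prod, measure_univ, one_mul]
      exact ih
    · rw [Measure.prod_apply_symm (herrm.inter (MeasurableSet.univ.prod hbadm.compl))]
      refine (lintegral_mono (g := fun _ => p) fun w => ?_).trans_eq
        (by rw [lintegral_const, measure_univ, mul_one])
      by_cases hw : w ∈ bad
      · have : (fun x => (x, w)) ⁻¹' (err ∩ Set.univ ×ˢ badᶜ) = ∅ := by
          ext b; simp [hw]
        simp only [this, measure_empty]
        exact zero_le
      · have h1 : Gs - S.cost 𝒟 K (S.zopg K L₀ r η T w) ≤ q ^ T * (Gs - S.cost 𝒟 K L₀) + ν := by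
          simpa only [hbad, Set.mem_ofPred_eq, not_lt] using hw
        have hqT : q ^ T ≤ 1 := pow_le_one₀ hq0 hq1
        refine (measure_mono ?_).trans (hp _ (h1.trans (le_trans (by nlinarith) hmax)))
        intro b hb
        exact hb.1

end Oracle

/-! ### Choice of the parameters -/

section Parameters

lemma half_le_log_two_div {x : ℝ} (hx : 0 < x) (hx1 : x < 1) : 1 / 2 ≤ Real.log (2 / x) := by
  have h1 : Real.log 2 ≤ Real.log (2 / x) :=
    Real.log_le_log (by norm_num) ((le_div_iff₀ hx).mpr (by linarith))
  linarith [Real.log_two_gt_d9]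

/-- The number of iterations suffices to reduce the initial gap to a prescribed fraction of `ε`:
the prescribed PL constant is smaller than the true one by the factor `k + 1`. -/
lemma pow_mul_gap_le {μ η Δ₀ ε : ℝ} (k T : ℕ) (hμ : 0 < μ) (hη : 0 < η)
    (hq : 0 ≤ 1 - η * μ / 4) (hΔ : 0 ≤ Δ₀) (hε : 0 < ε) (hε1 : ε < 1)
    (hT : 8 / (η * (μ / (k + 1))) * Real.log (2 * max 1 Δ₀ / ε) ≤ T) :
    (1 - η * μ / 4) ^ T * Δ₀ ≤ (1 / 2) ^ k * ε := by
  set X := 2 * max 1 Δ₀ / ε with hX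
  have hmx : 1 ≤ max 1 Δ₀ := le_max_left _ _
  have hX2 : 2 ≤ X := (le_div_iff₀ hε).mpr (by nlinarith)
  have hX0 : 0 < X := by linarith
  have hlog : 0 ≤ Real.log X := Real.log_nonneg (by linarith)
  have h1 : (1 - η * μ / 4) ^ T ≤ X⁻¹ ^ (k + 1) := by
    calc (1 - η * μ / 4) ^ T ≤ Real.exp (-(η * μ / 4)) ^ T :=
          pow_le_pow_left₀ hq (Real.one_sub_le_exp_neg _) T
      _ = Real.exp (-(η * μ / 4 * T)) := by rw [← Real.exp_nat_mul]; congr 1; ring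
      _ ≤ Real.exp (-((k + 1 : ℕ) * Real.log X)) := by
          refine Real.exp_le_exp.mpr (neg_le_neg ?_)
          have h2 := mul_le_mul_of_nonneg_left hT (show 0 ≤ η * μ / 4 by positivity)
          have h3 : η * μ / 4 * (8 / (η * (μ / (k + 1))) * Real.log X)
              = 2 * ((k + 1) * Real.log X) := by field_simp; ring
          rw [h3] at h2
          push_cast
          have : 0 ≤ ((k : ℝ) + 1) * Real.log X := by positivity
          linarith
      _ = X⁻¹ ^ (k + 1) := by
          rw [← mul_neg, Real.exp_nat_mul, Real.exp_neg, Real.exp_log hX0]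
  have hXinv : X⁻¹ ≤ 1 / 2 := by
    rw [one_div]; exact inv_anti₀ (by norm_num) hX2
  have hXΔ : X⁻¹ * Δ₀ ≤ ε := by
    rw [hX, inv_div, div_mul_eq_mul_div, div_le_iff₀ (by positivity)]
    have := le_max_right 1 Δ₀
    nlinarith
  calc (1 - η * μ / 4) ^ T * Δ₀ ≤ X⁻¹ ^ (k + 1) * Δ₀ := by gcongr
    _ = X⁻¹ ^ k * (X⁻¹ * Δ₀) := by ring
    _ ≤ (1 / 2) ^ k * ε := by gcongr

/-- The batch size makes the union bound over coordinates and iterations at most `δ`. -/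
lemma mul_exp_le_of_batch {D r B Γ μ ε δ τ : ℝ} {T M : ℕ} (hD : 0 < D) (hr : 0 < r) (hB : 0 < B)
    (hμ : 0 < μ) (hε : 0 < ε) (hδ : 0 < δ) (hT : 0 < T)
    (hlog : 0 ≤ Real.log (2 * D * T / δ))
    (hΓ : μ * B ^ 2 ≤ 512 * τ * Γ ^ 2)
    (hM : (D / r * Γ * √(Real.log (2 * D * T / δ))) ^ 2 * (1024 / (μ * ε)) ≤ M) (hτ : 0 ≤ τ) :
    T * (2 * D * Real.exp (-(M * (τ * ε) / (2 * (D / r * B) ^ 2)))) ≤ δ := by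
  have hT' : (0 : ℝ) < T := by positivity
  have hX : 0 < 2 * D * T / δ := by positivity
  have h1 : Real.log (2 * D * T / δ) ≤ M * (τ * ε) / (2 * (D / r * B) ^ 2) := by
    rw [le_div_iff₀ (by positivity)]
    have h2 := mul_le_mul_of_nonneg_right hM (show 0 ≤ τ * ε by positivity)
    refine le_trans ?_ h2
    have hexp : (D / r * Γ * √(Real.log (2 * D * T / δ))) ^ 2
        = (D / r) ^ 2 * Γ ^ 2 * Real.log (2 * D * T / δ) := by
      rw [mul_pow, mul_pow, Real.sq_sqrt hlog]
    rw [hexp]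
    have h3 := mul_le_mul_of_nonneg_left hΓ
      (show 0 ≤ Real.log (2 * D * T / δ) * (D / r) ^ 2 * (2 / μ) by positivity)
    have h4 : Real.log (2 * D * T / δ) * (D / r) ^ 2 * (2 / μ) * (μ * B ^ 2)
        = Real.log (2 * D * T / δ) * (2 * (D / r * B) ^ 2) := by field_simp
    have h5 : Real.log (2 * D * T / δ) * (D / r) ^ 2 * (2 / μ) * (512 * τ * Γ ^ 2)
        = (D / r) ^ 2 * Γ ^ 2 * Real.log (2 * D * T / δ) * (1024 / (μ * ε)) * (τ * ε) := by
      field_simp; ring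
    rw [h4, h5] at h3
    exact h3
  calc T * (2 * D * Real.exp (-(M * (τ * ε) / (2 * (D / r * B) ^ 2))))
      ≤ T * (2 * D * Real.exp (-Real.log (2 * D * T / δ))) := by gcongr
    _ = δ := by rw [Real.exp_neg, Real.exp_log hX]; field_simp

lemma le_two_mul_mul {x y : ℝ} (hx : 0 ≤ x) (hy : 1 / 2 ≤ y) : x ≤ 2 * (x * y) := by
  nlinarith

/-- Admissible parameters with `T = O(log (1/ε))`, `r ∼ √ε` and a batch size of order
`ε⁻² log (T/δ)`. -/
lemma exists_admissible {d₁ : ℕ} (hd : 0 < d₁) {Gs μ l ψ : ℝ} (hμ : 0 < μ) (hl : 0 < l)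
    (hψ : 0 < ψ) (hGl : 0 < Gs + l) (Δmax : ℝ) :
    ∃ C : ℝ, 0 < C ∧ ∀ Δ₀ ≤ Δmax, ∀ ε δ : ℝ, 0 < ε → ε < 1 → 0 < δ → δ < 1 →
      ∃ (T M : ℕ) (r η : ℝ), LQGame.Admissible d₁ Gs Δ₀ μ l ψ 1 ε δ T M r η ∧
        (T * M : ℝ) ≤ C * (ε ^ 2)⁻¹ * Real.log (2 / ε) ^ 2 * Real.log (2 / δ) := by
  have hd' : (1 : ℝ) ≤ d₁ := by exact_mod_cast hd
  set η : ℝ := min (min 1 (1 / (8 * ψ))) (1 * (√μ / 32 + ψ + l)⁻¹) with hη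
  have hη0 : 0 < η := by positivity
  set r₀ : ℝ := min (min (min (1 / (2 * ψ)) (1 / l) * μ / (8 * ψ) * √(1 / 240))
    (1 / (8 * ψ ^ 2) * √(μ / 30))) 1 with hr₀
  have hr₀0 : 0 < r₀ := by positivity
  set α : ℝ := 8 / (η * μ) with hα
  have hα0 : 0 < α := by positivity
  set w : ℝ := Real.log (max 1 Δmax) with hw
  have hw0 : 0 ≤ w := Real.log_nonneg (le_max_left _ _)
  set τ : ℝ := α * (2 * w + 1) + 2 with hτ
  have hτ0 : 0 < τ := by positivity
  set β : ℝ := (d₁ / r₀ * (Gs + l)) ^ 2 * (1024 / μ) with hβ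
  have hβ0 : 0 < β := by positivity
  refine ⟨τ * (β * (2 * d₁ * τ + 2) + 4), by positivity, ?_⟩
  intro Δ₀ hΔ₀ ε δ hε hε1 hδ hδ1
  have hℓ := half_le_log_two_div hε hε1
  have hℓδ := half_le_log_two_div hδ hδ1
  set ℓ := Real.log (2 / ε)
  set ℓδ := Real.log (2 / δ)
  set T : ℕ := ⌈α * Real.log (2 * max 1 Δ₀ / ε)⌉₊ with hT
  set Λ := Real.log (2 * d₁ * T / δ) with hΛ
  set y : ℝ := (d₁ / (r₀ * √ε) * (Gs + l / 1) * √Λ) ^ 2 * (1024 / (μ * ε)) with hy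
  have hmx : (1 : ℝ) ≤ max 1 Δ₀ := le_max_left _ _
  have hlogX : Real.log (2 * max 1 Δ₀ / ε) = Real.log (max 1 Δ₀) + ℓ := by
    rw [← Real.log_mul (by positivity) (by positivity)]
    congr 1; ring
  have hlogmx0 : 0 ≤ Real.log (max 1 Δ₀) := Real.log_nonneg hmx
  have hlogmx : Real.log (max 1 Δ₀) ≤ w :=
    Real.log_le_log (by positivity) (max_le_max le_rfl hΔ₀)
  have hTpos : 0 < T := by
    refine Nat.ceil_pos.mpr (mul_pos hα0 ?_)
    rw [hlogX]; linarith
  have hT1 : (1 : ℝ) ≤ T := by exact_mod_cast hTpos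
  have hTle : (T : ℝ) ≤ τ * ℓ := by
    have h1 : (T : ℝ) ≤ α * Real.log (2 * max 1 Δ₀ / ε) + 1 :=
      (Nat.ceil_lt_add_one (mul_nonneg hα0.le (by rw [hlogX]; linarith))).le
    rw [hlogX] at h1
    have h2 : Real.log (max 1 Δ₀) + ℓ ≤ (2 * w + 1) * ℓ := by
      linarith [le_two_mul_mul hw0 hℓ]
    have h3 := mul_le_mul_of_nonneg_left h2 hα0.le
    rw [hτ]
    linarith
  have hΛsplit : Λ = Real.log (d₁ * T) + ℓδ := by
    rw [hΛ, ← Real.log_mul (by positivity) (by positivity)]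
    congr 1; ring
  have hΛ0 : 0 ≤ Λ := by
    have : 0 ≤ Real.log (d₁ * T) := Real.log_nonneg (one_le_mul_of_one_le_of_one_le hd' hT1)
    linarith
  have hΛle : Λ ≤ (2 * d₁ * τ + 2) * (ℓ * ℓδ) := by
    have h1 : Real.log (d₁ * T) ≤ d₁ * T := Real.log_le_self (by positivity)
    have h2 : (d₁ : ℝ) * T ≤ d₁ * (τ * ℓ) := by gcongr
    have h3 : (d₁ : ℝ) * τ * ℓ ≤ d₁ * τ * (2 * (ℓ * ℓδ)) := by
      gcongr
      exact le_two_mul_mul (by linarith) hℓδ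
    have h4 : ℓδ ≤ 2 * (ℓ * ℓδ) := by
      rw [mul_comm ℓ]
      exact le_two_mul_mul (by linarith) hℓ
    rw [hΛsplit]
    linarith
  have hyeq : y = β * (ε ^ 2)⁻¹ * Λ := by
    rw [hy, hβ, mul_pow, Real.sq_sqrt hΛ0, div_one, mul_pow, div_pow, mul_pow,
      Real.sq_sqrt hε.le]
    field_simp
  have hMle : (⌈y⌉₊ : ℝ) ≤ (β * (2 * d₁ * τ + 2) + 4) * ((ε ^ 2)⁻¹ * (ℓ * ℓδ)) := by
    have h1 : (⌈y⌉₊ : ℝ) ≤ y + 1 := (Nat.ceil_lt_add_one (by rw [hyeq]; positivity)).le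
    have h2 : y ≤ β * (ε ^ 2)⁻¹ * ((2 * d₁ * τ + 2) * (ℓ * ℓδ)) := by rw [hyeq]; gcongr
    have h3 : 1 ≤ (ε ^ 2)⁻¹ := (one_le_inv₀ (by positivity)).mpr (pow_le_one₀ hε.le hε1.le)
    have h4 : 1 ≤ 4 * (ℓ * ℓδ) := by linarith [le_two_mul_mul (by linarith : 0 ≤ ℓ) hℓδ]
    have h5 : ℓ * ℓδ ≤ (ε ^ 2)⁻¹ * (ℓ * ℓδ) :=
      le_mul_of_one_le_left (by linarith) h3
    linarith
  have hsq : √ε ≤ 1 := Real.sqrt_le_one.mpr hε1.le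
  have hsq0 : 0 < √ε := Real.sqrt_pos.mpr hε
  refine ⟨T, ⌈y⌉₊, r₀ * √ε, η, ⟨by positivity, hη0, Nat.le_ceil _, Nat.le_ceil _, ?_, le_rfl⟩, ?_⟩
  · have h240 : √(ε / 240) = √(1 / 240) * √ε := by
      rw [← Real.sqrt_mul (by norm_num)]; congr 1; ring
    have h30 : √(ε * μ / 30) = √(μ / 30) * √ε := by
      rw [← Real.sqrt_mul (by positivity)]; congr 1; ring
    refine le_min (le_min ?_ ?_) ?_
    · rw [h240, ← mul_assoc]
      exact mul_le_mul_of_nonneg_right ((min_le_left _ _).trans (min_le_left _ _)) hsq0.le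
    · rw [h30, ← mul_assoc]
      exact mul_le_mul_of_nonneg_right ((min_le_left _ _).trans (min_le_right _ _)) hsq0.le
    · exact mul_le_one₀ (min_le_right _ _) hsq0.le hsq
  · calc (T * ⌈y⌉₊ : ℝ)
        ≤ (τ * ℓ) * ((β * (2 * d₁ * τ + 2) + 4) * ((ε ^ 2)⁻¹ * (ℓ * ℓδ))) := by gcongr
      _ = _ := by ring

lemma one_sub_le_measureReal {Ω : Type*} [MeasurableSpace Ω] {P : Measure Ω}
    [IsProbabilityMeasure P] {good bad : Set Ω} (h : ∀ ω, ω ∉ bad → ω ∈ good) {δ : ℝ} (hδ : 0 ≤ δ)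
    (hb : P bad ≤ ENNReal.ofReal δ) : 1 - δ ≤ P.real good := by
  have h1 : P.real bad ≤ δ := ENNReal.toReal_le_of_le_ofReal hδ hb
  have h2 : P.real Set.univ ≤ P.real (good ∪ bad) :=
    measureReal_mono fun ω _ => by
      by_cases hω : ω ∈ bad
      · exact .inr hω
      · exact .inl (h ω hω)
  have h3 := measureReal_union_le (μ := P) good bad
  rw [probReal_univ] at h2
  linarith

end Parameters

/-! ### The guarantee on a superlevel set -/

lemma lambdaMin_H_pos {m n d N : ℕ} (hn : 0 < n) (hN : 0 < N) (S : LQGame m n d N)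
    {K : Gain d m N} (hK : K ∈ S.feasible) : 0 < lambdaMin (S.H K (S.innerSol K)) := by
  have : Nonempty (Fin n × Fin N) := ⟨⟨0, hn⟩, ⟨0, hN⟩⟩
  exact lambdaMin_pos (posDef_blockDiagonal fun t => posDef_curvature_innerSol S hK t)

/-- The guarantee of zeroth-order policy gradient, for explicit lower bounds on the prescribed
constants `l` and `ψ` in terms of the regularity constant `c` of the objective on the ball of radius
`R + 1`, where `R` bounds the gains with optimality gap at most `Δ₀ + 1`, and of the bound `B` on
trajectory costs. The final gap is the fraction `f` of `ε`, and `τ₀ * ε` is the tolerated squared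
error in one coordinate of a gradient estimate. -/
lemma one_sub_le_runLaw_gap {m n d N : ℕ} (hm : 0 < m) (hn : 0 < n) (hN : 0 < N)
    (S : LQGame m n d N) {𝒟 : Measure (EuclideanSpace ℝ (Fin m))} [IsProbabilityMeasure 𝒟]
    {ϑ : ℝ} (hϑ : ∀ᵐ x ∂𝒟, ‖x‖ ≤ ϑ) (K : Gain d m N)
    (hsm : ContDiff ℝ 2 (S.cost 𝒟 K : Gain n m N → ℝ))
    {Gs μ f c B R l ψ : ℝ} {k : ℕ} (hμ : 0 < μ) (hf1 : f ≤ 1) (hB : 0 < B)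
    (hc : 0 < c) (hk : (1 / 2 : ℝ) ^ k ≤ f / 2)
    (hPL : ∀ L : Gain n m N, μ * (Gs - S.cost 𝒟 K L) ≤ ‖gradient (S.cost 𝒟 K) L‖ ^ 2)
    (hreg : RegularOnBall (S.cost 𝒟 K : Gain n m N → ℝ) c (R + 1))
    (hroll : ∀ (L : Gain n m N) (ζ : Noise m N),
      ‖L‖ ≤ R + 1 → (∀ s, ‖ζ s‖ ≤ ϑ) → |S.rolloutCost K L ζ| ≤ B)
    (L₀ : Gain n m N) (hΔ₀ : 0 ≤ Gs - S.cost 𝒟 K L₀)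
    (hR : ∀ L : Gain n m N, Gs - S.cost 𝒟 K L ≤ Gs - S.cost 𝒟 K L₀ + 1 → ‖L‖ ≤ R)
    {τ₀ : ℝ} (hτ₀ : 0 < τ₀)
    (hτ₀f : 4 * ((n * m * N : ℕ) : ℝ) * τ₀ ≤ min 1 (f * μ / 8))
    (hl1 : 1 ≤ l) (hψ1 : 1 ≤ ψ) (hcψ : c ≤ ψ) (hμψ : μ ≤ ψ)
    (hΓ0 : 0 < Gs + l) (hΓ : μ / (k + 1) * B ^ 2 ≤ 512 * τ₀ * (Gs + l) ^ 2)
    (hψb : ((n * m * N : ℕ) : ℝ) * c * √(μ / (k + 1) / 30) ≤ ψ * √τ₀)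
    {ε δ : ℝ} (hε : 0 < ε) (hε1 : ε < 1) (hδ : 0 < δ) (hδ1 : δ < 1) {T M : ℕ} {r η : ℝ}
    (hadm : LQGame.Admissible (n * m * N) Gs (Gs - S.cost 𝒟 K L₀) (μ / (k + 1)) l ψ 1 ε δ
      T M r η) :
    1 - δ ≤ (runLaw n N 𝒟 T M).real
      {ω | Gs - S.cost 𝒟 K (S.zopg K L₀ r η T ω) ≤ f * ε} := by
  have hprob := isProbabilityMeasure_uniformSphere hn hm hN
  have hrunprob : IsProbabilityMeasure (runLaw n N 𝒟 T M) := by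
    unfold runLaw; infer_instance
  obtain ⟨hr, hη, hT, hM, hrad, hstep⟩ := hadm
  have hdpos : 0 < n * m * N := by positivity
  have hD1 : (1 : ℝ) ≤ ((n * m * N : ℕ) : ℝ) := by exact_mod_cast hdpos
  obtain ⟨D, hD⟩ : ∃ D : ℝ, D = ((n * m * N : ℕ) : ℝ) := ⟨_, rfl⟩
  rw [← hD] at hM hD1 hψb hτ₀f
  rw [div_one] at hM
  have hμk : 0 < μ / (k + 1) := by positivity
  have hψ0 : 0 < ψ := by linarith
  have hl0 : 0 < l := by linarith
  -- consequences of the stepsize condition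
  have hηψ : η * (8 * ψ) ≤ 1 := by
    have := (hstep.trans (min_le_left _ _)).trans (min_le_right _ _)
    rwa [le_div_iff₀ (by positivity)] at this
  have hηsum : η * (ψ + l) ≤ 1 := by
    have h1 := hstep.trans (min_le_right _ _)
    rw [one_mul, ← one_div, le_div_iff₀ (by positivity)] at h1
    have h2 : 0 ≤ η * (√(μ / (k + 1)) / 32) := by positivity
    linarith
  have hη1 : η * (c + 1) ≤ 1 := le_trans (by gcongr) hηsum
  have hη2 : η * (8 * c) ≤ 1 := le_trans (by gcongr) hηψ
  have hημ : η * μ ≤ 1 := by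
    have : η * μ ≤ η * (8 * ψ) := by
      gcongr
      linarith
    linarith
  have hq0 : 0 ≤ 1 - η * μ / 4 := by linarith
  have hq1 : 1 - η * μ / 4 ≤ 1 := by
    have : 0 < η * μ := by positivity
    linarith
  -- there is at least one iteration and one sample
  have hlogX : 1 / 2 ≤ Real.log (2 * max 1 (Gs - S.cost 𝒟 K L₀) / ε) := by
    refine (half_le_log_two_div hε hε1).trans (Real.log_le_log (by positivity) ?_)
    have : (1 : ℝ) ≤ max 1 (Gs - S.cost 𝒟 K L₀) := le_max_left _ _
    gcongr
    linarith
  have hT0 : 0 < T := by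
    have : (0 : ℝ) < T := lt_of_lt_of_le (mul_pos (by positivity) (by linarith)) hT
    exact_mod_cast this
  have hT1 : (1 : ℝ) ≤ T := by exact_mod_cast hT0
  have hDT : 1 ≤ D * T := one_le_mul_of_one_le_of_one_le hD1 hT1
  have hΛ : 0 < Real.log (2 * D * T / δ) := by
    refine Real.log_pos ((one_lt_div hδ).mpr ?_)
    linarith
  have hM0 : 0 < M := by
    have : (0 : ℝ) < M := by
      refine lt_of_lt_of_le ?_ hM
      have := Real.sqrt_pos.mpr hΛ
      positivity
    exact_mod_cast this
  -- the tolerated error `e` of the gradient estimates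
  obtain ⟨e, he⟩ : ∃ e : ℝ, e = √(4 * D * τ₀ * ε) := ⟨_, rfl⟩
  have he0 : 0 ≤ e := he ▸ Real.sqrt_nonneg _
  have hesq : e ^ 2 = 4 * D * τ₀ * ε := by rw [he, Real.sq_sqrt (by positivity)]
  have hesq1 : e ^ 2 ≤ 1 := by
    rw [hesq]
    exact mul_le_one₀ (hτ₀f.trans (min_le_left _ _)) hε.le hε1.le
  have he1 : e ≤ 1 := (sq_le_one_iff₀ he0).mp hesq1
  have hesqf : 4 * e ^ 2 / μ ≤ f / 2 * ε := by
    rw [div_le_iff₀ hμ, hesq]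
    have := mul_le_mul_of_nonneg_right (hτ₀f.trans (min_le_right _ _)) hε.le
    linarith
  -- the smoothing bias is at most half of it in each coordinate
  have hr1 : r ≤ 1 := hrad.trans (min_le_right _ _)
  have hbias : D * (c * r) ≤ √(τ₀ * ε) := by
    have h1 := (hrad.trans (min_le_left _ _)).trans (min_le_right _ _)
    have h2 : 1 / (8 * ψ ^ 2) ≤ 1 / ψ := by
      refine one_div_le_one_div_of_le hψ0 ?_
      nlinarith only [hψ1]
    have h3 : √(ε * (μ / (k + 1)) / 30) = √(μ / (k + 1) / 30) * √ε := by
      rw [← Real.sqrt_mul (by positivity)]; congr 1; ring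
    rw [h3] at h1
    calc D * (c * r) ≤ D * (c * (1 / ψ * (√(μ / (k + 1) / 30) * √ε))) := by
          gcongr
          exact h1.trans (by gcongr)
      _ = 1 / ψ * (D * c * √(μ / (k + 1) / 30)) * √ε := by ring
      _ ≤ 1 / ψ * (ψ * √τ₀) * √ε := by gcongr
      _ = √(τ₀ * ε) := by
          rw [Real.sqrt_mul hτ₀.le]; field_simp
  have hte : D * (D * (c * r) + √(τ₀ * ε)) ^ 2 ≤ e ^ 2 := by
    have h1 : (D * (c * r) + √(τ₀ * ε)) ^ 2 ≤ (2 * √(τ₀ * ε)) ^ 2 := by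
      gcongr
      linarith
    rw [mul_pow, Real.sq_sqrt (by positivity)] at h1
    rw [hesq]
    have h2 := mul_le_mul_of_nonneg_left h1 (by linarith : 0 ≤ D)
    linarith
  have hΔmax : 4 * e ^ 2 / μ ≤ 1 := by
    refine hesqf.trans ?_
    linarith [mul_le_one₀ hf1 hε.le hε1.le]
  refine one_sub_le_measureReal (bad := {ω | (1 - η * μ / 4) ^ T * (Gs - S.cost 𝒟 K L₀)
    + 4 * e ^ 2 / μ < Gs - S.cost 𝒟 K (S.zopg K L₀ r η T ω)}) (fun ω hω => ?_) hδ.le ?_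
  · simp only [Set.mem_ofPred_eq, not_lt] at hω ⊢
    have h1 := pow_mul_gap_le k T hμ hη hq0 hΔ₀ hε hε1 hT
    have h2 := mul_le_mul_of_nonneg_right hk hε.le
    linarith
  · refine (runLaw_gap_le S K hm hn hN hsm (p := ENNReal.ofReal (2 * D
      * Real.exp (-(M * (τ₀ * ε) / (2 * (D / r * B) ^ 2))))) (e := e)
      (Δmax := Gs - S.cost 𝒟 K L₀ + 1) L₀ hq0 hq1 hΔ₀ (by positivity)
      (by linarith) (fun L hL => ?_) (fun L g hL hg => ?_) T).trans ?_
    · have h := measure_gradEst_error_le S K hm hn hN hϑ hB hreg hsm.continuous hroll hM0 hr hr1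
        (t := √(τ₀ * ε)) (Real.sqrt_nonneg _) he0 (by rw [← hD]; exact hte) (hR L hL)
      rwa [← hD, Real.sq_sqrt (by positivity)] at h
    · refine (gap_ascent_step_le hreg hPL (hR L hL) hη hη1 hη2 hg he1).trans_eq ?_
      field_simp
      ring
    · rw [← ENNReal.ofReal_natCast, ← ENNReal.ofReal_mul (by positivity)]
      exact ENNReal.ofReal_le_ofReal (mul_exp_le_of_batch (by linarith) hr hB hμk hε hδ hT0 hΛ.le
        hΓ hM hτ₀.le)

end ZOGame

open ZOGame in
theorem theorem4p1 {m n d N : ℕ} (hm : 0 < m) (hn : 0 < n) (hN : 0 < N)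
    (S : ZOGame.LQGame m n d N)
    (𝒟 : MeasureTheory.Measure (EuclideanSpace ℝ (Fin m)))
    [MeasureTheory.IsProbabilityMeasure 𝒟]
    (hmean : ∫ x, x ∂𝒟 = 0) (hcov : (ZOGame.secondMoment 𝒟).PosDef)
    (ϑ : ℝ) (hϑ : ∀ᵐ x ∂𝒟, ‖x‖ ≤ ϑ)
    (K : ZOGame.Gain d m N) (hK : K ∈ S.feasible) :
    -- PL constant and local curvature constants, depending only on `K` and the game
    ∃ (μ : ℝ) (lloc ψloc ρloc : ZOGame.Gain n m N → ℝ),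
      0 < μ ∧ S.IsPL 𝒟 K μ ∧
      (∀ L, 0 < lloc L ∧ 0 < ψloc L ∧ 0 < ρloc L ∧
        S.LipSmooth 𝒟 K (lloc L) (ψloc L) (fun L₁ L₂ => L₁ = L ∧ ‖L₂ - L₁‖ ≤ ρloc L)) ∧
      ∀ a : ℝ, (S.superlevel 𝒟 K a).Nonempty →
        -- curvature constants of the superlevel set, depending also on `a`
        ∃ l ψ ρ : ℝ, 0 < l ∧ 0 < ψ ∧
          IsLeast (ρloc '' S.superlevel 𝒟 K a) ρ ∧
          (∀ L ∈ S.superlevel 𝒟 K a, lloc L ≤ l ∧ ψloc L ≤ ψ) ∧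
          S.LipSmooth 𝒟 K l ψ
            (fun L₁ L₂ => L₁ ∈ S.superlevel 𝒟 K a ∧ L₂ ∈ S.superlevel 𝒟 K a) ∧
          -- the guarantee, for every admissible choice of the parameters
          (∀ L₀ ∈ S.superlevel 𝒟 K a, ∀ ε δ : ℝ, 0 < ε → ε < 1 → 0 < δ → δ < 1 →
            ∀ (T M : ℕ) (r η : ℝ),
              ZOGame.LQGame.Admissible (n * m * N) (S.cost 𝒟 K (S.innerSol K))
                (S.cost 𝒟 K (S.innerSol K) - S.cost 𝒟 K L₀) μ l ψ ρ ε δ T M r η →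
              1 - δ ≤ (ZOGame.runLaw n N 𝒟 T M).real
                {ω | S.cost 𝒟 K (S.innerSol K) - ε ≤ S.cost 𝒟 K (S.zopg K L₀ r η T ω) ∧
                  ‖S.innerSol K - S.zopg K L₀ r η T ω‖ ≤
                    √((ZOGame.lambdaMin (S.H K (S.innerSol K)))⁻¹ * ε)}) ∧
          -- the total number `T * M` of sampled trajectories is of order `ε⁻² log (1/δ)` up to
          -- logarithmic factors in `1/ε`
          ∃ C : ℝ, 0 < C ∧
            ∀ L₀ ∈ S.superlevel 𝒟 K a, ∀ ε δ : ℝ, 0 < ε → ε < 1 → 0 < δ → δ < 1 →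
              ∃ (T M : ℕ) (r η : ℝ),
                ZOGame.LQGame.Admissible (n * m * N) (S.cost 𝒟 K (S.innerSol K))
                  (S.cost 𝒟 K (S.innerSol K) - S.cost 𝒟 K L₀) μ l ψ ρ ε δ T M r η ∧
                (T * M : ℝ) ≤
                  C * (ε ^ 2)⁻¹ * Real.log (2 / ε) ^ 2 * Real.log (2 / δ) := by
  have hsm : ContDiff ℝ 2 (S.cost 𝒟 K : Gain n m N → ℝ) := contDiff_cost S K hϑ hmean
  obtain ⟨κ, hκ, hgrowth⟩ := exists_quadratic_growth S hN hϑ hmean hcov hK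
  obtain ⟨μ, hμ, hPL⟩ := exists_isPL (n := n) S hN hϑ hmean hcov hK
  obtain ⟨c, hcmono, hcpos, hc⟩ := exists_monotone_regularOnBall hsm
  have hlam := lambdaMin_H_pos hn hN S hK
  obtain ⟨lam, hlam_eq⟩ : ∃ lam, lam = lambdaMin (S.H K (S.innerSol K)) := ⟨_, rfl⟩
  obtain ⟨Gs, hGs⟩ : ∃ Gs, Gs = S.cost 𝒟 K (S.innerSol K) := ⟨_, rfl⟩
  rw [← hlam_eq] at hlam ⊢
  have hPL' : ∀ L : Gain n m N, μ * (Gs - S.cost 𝒟 K L) ≤ ‖gradient (S.cost 𝒟 K) L‖ ^ 2 := by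
    rw [hGs]; exact hPL
  rw [← hGs] at hgrowth ⊢
  have hgap : ∀ L : Gain n m N, 0 ≤ Gs - S.cost 𝒟 K L := fun L =>
    (by positivity : 0 ≤ κ * ‖S.innerSol K - L‖ ^ 2).trans (hgrowth L)
  -- With a final gap of `f * ε`, quadratic growth gives the claimed distance to the maximizer.
  obtain ⟨f, hf⟩ : ∃ f, f = min 1 (κ / lam) := ⟨_, rfl⟩
  have hf0 : 0 < f := by rw [hf]; positivity
  have hf1 : f ≤ 1 := by rw [hf]; exact min_le_left _ _
  have hfκ : f ≤ κ / lam := by rw [hf]; exact min_le_right _ _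
  obtain ⟨k, hk⟩ : ∃ k : ℕ, (1 / 2 : ℝ) ^ k < f / 2 :=
    exists_pow_lt_of_lt_one (by positivity) (by norm_num)
  -- The prescribed constant is smaller than the PL constant `μ`: it only enters the iteration
  -- count, which then suffices to reach the gap `f * ε` instead of `ε`.
  refine ⟨μ / (k + 1), fun L => c (‖L‖ + 1), fun L => c (‖L‖ + 1), fun _ => 1, by positivity,
    fun L => ?_, fun L => ⟨hcpos _, hcpos _, one_pos, ?_⟩, ?_⟩
  · refine (mul_le_mul_of_nonneg_right (div_le_self hμ.le ?_) ?_).trans (hPL L)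
    · linarith [k.cast_nonneg (α := ℝ)]
    · rw [← hGs]; exact hgap L
  · rintro L₁ L₂ ⟨rfl, h⟩
    have hL₂ : ‖L₂‖ ≤ ‖L₁‖ + 1 := by
      have := norm_add_le L₁ (L₂ - L₁)
      rw [add_sub_cancel] at this
      linarith
    exact ⟨(hc _).abs_sub_le _ _ (by linarith) hL₂,
      (hc _).norm_gradient_sub_le _ _ (by linarith) hL₂⟩
  intro a ha
  -- the radius of a ball containing all gains with optimality gap at most `|Gs - a| + 1`
  obtain ⟨R, hR⟩ : ∃ R : ℝ, ∀ L : Gain n m N, Gs - S.cost 𝒟 K L ≤ |Gs - a| + 1 → ‖L‖ ≤ R := by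
    refine ⟨‖S.innerSol K‖ + √((|Gs - a| + 1) / κ), fun L hL => ?_⟩
    have h1 : ‖S.innerSol K - L‖ ≤ √((|Gs - a| + 1) / κ) := by
      refine Real.le_sqrt_of_sq_le ((le_div_iff₀ hκ).mpr ?_)
      linarith [hgrowth L]
    have h2 := norm_sub_le (S.innerSol K) (S.innerSol K - L)
    rw [sub_sub_cancel] at h2
    linarith
  have hsup : ∀ L ∈ S.superlevel 𝒟 K a, Gs - S.cost 𝒟 K L ≤ |Gs - a| := fun L hL => by
    have h1 : a ≤ S.cost 𝒟 K L := hL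
    linarith [le_abs_self (Gs - a)]
  have hRsup : ∀ L ∈ S.superlevel 𝒟 K a, ‖L‖ ≤ R := fun L hL => hR L (by linarith [hsup L hL])
  obtain ⟨B, hB, hroll⟩ := exists_rolloutCost_bound (n := n) S K (R + 1) ϑ
  obtain ⟨c₁, hc₁⟩ : ∃ c₁, c₁ = c (R + 1) := ⟨_, rfl⟩
  have hc₁pos : 0 < c₁ := hc₁ ▸ hcpos _
  have hreg : RegularOnBall (S.cost 𝒟 K : Gain n m N → ℝ) c₁ (R + 1) := hc₁ ▸ hc _
  have hdpos : 0 < n * m * N := by positivity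
  obtain ⟨D, hD⟩ : ∃ D : ℝ, D = ((n * m * N : ℕ) : ℝ) := ⟨_, rfl⟩
  have hD0 : 0 < D := by rw [hD]; exact_mod_cast hdpos
  -- `τ₀ * ε` is the tolerated squared error in one coordinate of a gradient estimate
  obtain ⟨τ₀, hτ₀⟩ : ∃ τ₀, τ₀ = min 1 (f * μ / 8) / (4 * D) := ⟨_, rfl⟩
  have hτ₀pos : 0 < τ₀ := by rw [hτ₀]; positivity
  have hτ₀f : 4 * D * τ₀ ≤ min 1 (f * μ / 8) := by
    rw [hτ₀, mul_div_cancel₀ _ (by positivity)]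
  have hμk : 0 < μ / (k + 1) := by positivity
  obtain ⟨b, hb⟩ : ∃ b : ℝ, b = √(μ / (k + 1) * B ^ 2 / (512 * τ₀)) := ⟨_, rfl⟩
  have hb0 : 0 ≤ b := hb ▸ Real.sqrt_nonneg _
  obtain ⟨l, hl⟩ : ∃ l : ℝ, l = c₁ + 1 + |Gs| + b := ⟨_, rfl⟩
  obtain ⟨b', hb'⟩ : ∃ b' : ℝ, b' = D * c₁ * √(μ / (k + 1) / 30) / √τ₀ := ⟨_, rfl⟩
  have hb'0 : 0 ≤ b' := by rw [hb']; positivity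
  obtain ⟨ψ, hψ⟩ : ∃ ψ : ℝ, ψ = c₁ + 1 + μ + b' := ⟨_, rfl⟩
  have habs := abs_nonneg Gs
  have habs' := neg_abs_le Gs
  have hcl : c₁ ≤ l := by linarith
  have hcψ : c₁ ≤ ψ := by linarith
  have hGl : b ≤ Gs + l := by linarith
  have hGl0 : 0 < Gs + l := by linarith
  have hΓ : μ / (k + 1) * B ^ 2 ≤ 512 * τ₀ * (Gs + l) ^ 2 := by
    have h1 : b ^ 2 ≤ (Gs + l) ^ 2 := by gcongr
    rw [hb, Real.sq_sqrt (by positivity), div_le_iff₀ (by positivity)] at h1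
    linarith
  have hψb : D * c₁ * √(μ / (k + 1) / 30) ≤ ψ * √τ₀ := by
    have h1 : b' ≤ ψ := by linarith
    rwa [hb', div_le_iff₀ (Real.sqrt_pos.mpr hτ₀pos)] at h1
  refine ⟨l, ψ, 1, by linarith, by linarith, ?_, fun L hL => ?_, ?_, ?_, ?_⟩
  · rw [ha.image_const]
    exact isLeast_singleton
  · have h1 : c (‖L‖ + 1) ≤ c₁ := hc₁ ▸ hcmono (by linarith [hRsup L hL])
    exact ⟨h1.trans hcl, h1.trans hcψ⟩
  · rintro L₁ L₂ ⟨h1, h2⟩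
    have h1' : ‖L₁‖ ≤ R + 1 := by linarith [hRsup L₁ h1]
    have h2' : ‖L₂‖ ≤ R + 1 := by linarith [hRsup L₂ h2]
    exact ⟨(hreg.abs_sub_le _ _ h1' h2').trans (by gcongr),
      (hreg.norm_gradient_sub_le _ _ h1' h2').trans (by gcongr)⟩
  · intro L₀ hL₀ ε δ hε hε1 hδ hδ1 T M r η hadm
    have hprob := isProbabilityMeasure_uniformSphere hn hm hN
    have hrunprob : IsProbabilityMeasure (runLaw n N 𝒟 T M) := by
      unfold runLaw; infer_instance
    refine (one_sub_le_runLaw_gap hm hn hN S hϑ K hsm hμ hf1 hB hc₁pos hk.le hPL' hreg hroll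
      L₀ (hgap L₀) (fun L hL => hR L (by linarith [hsup L₀ hL₀])) hτ₀pos (by rw [← hD]; exact hτ₀f)
      (by linarith) (by linarith) hcψ (by linarith) hGl0 hΓ (by rw [← hD]; exact hψb)
      hε hε1 hδ hδ1 hadm).trans (measureReal_mono fun ω hω => ?_)
    have hω' : Gs - S.cost 𝒟 K (S.zopg K L₀ r η T ω) ≤ f * ε := hω
    refine ⟨by linarith [mul_le_of_le_one_left hε.le hf1], Real.le_sqrt_of_sq_le ?_⟩
    have h1 := (hgrowth (S.zopg K L₀ r η T ω)).trans hω'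
    have h2 : f * ε ≤ κ / lam * ε := mul_le_mul_of_nonneg_right hfκ hε.le
    have h3 : κ / lam * ε = κ * (lam⁻¹ * ε) := by ring
    exact le_of_mul_le_mul_left (h1.trans (h2.trans_eq h3)) hκ
  · obtain ⟨C, hC, h⟩ := exists_admissible hdpos hμk (by linarith : 0 < l) (by linarith : 0 < ψ)
      hGl0 |Gs - a|
    exact ⟨C, hC, fun L₀ hL₀ => h _ (hsup L₀ hL₀)⟩
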